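/- Conventions. Every connected graph carries its shortest-path metric. Given a finite sequence $W=(w_r)_{r=0}^{M+1}$ of non-negative integers ($M\ge 0$) with $w_0=w_{M+1}=0$ and an integer $\kappa\ge 1$, the *$\kappa$-branching bundle graph* $T_{W,\kappa}$ has as vertices the pairs $(r,A)$ with $0\le r\le M+1$ and $A\in\{0,\dots,\kappa-1\}^{w_r}$; two vertices $(r,A)$, $(s,B)$ are adjacent if and only if $|r-s|=1$ and one of the finite sequences $A,B$ is an initial segment of the other. Its bottom is $(0,\emptyset)$ and its top is $(M+1,\emptyset)$. For graphs $G,H$ with a distinguished bottom and top, $G\oslash H$ is obtained by replacing every edge of $G$ with a copy of $H$, the bottom of $H$ being identified with the endpoint of the edge closer to the bottom of $G$ and the top of $H$ with the other endpoint; the bottom and top of $G\oslash H$ are those of $G$. Put $G^{\oslash^1}=G$ and $G^{\oslash^{k+1}}=G^{\oslash^k}\oslash G$; the *family generated by $G$* is $\{G^{\oslash^k}\}_{k\ge 1}$. The families of $\kappa$-branching diamond, Laakso and parasol graphs are the families generated by $T_{(0,1,0),\kappa}$, $T_{(0,0,1,0,0),\kappa}$ and $T_{(0,0,1,0),\kappa}$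 respectively. An *ESA (equal-signs-additive) basis* of a real Banach space $X$ is a Schauder basis $(e_n)_{n=1}^\infty$ of $X$ such that $$\Big\|\sum_{n=1}^{k-1}a_ne_n+(a_k+a_{k+1})e_k+\sum_{n=k+2}^\infty a_ne_n\Big\|=\Big\|\sum_{n=1}^\infty a_ne_n\Big\|$$ for all finitely supported real sequences $(a_n)$ and all $k\ge 1$ with $a_ka_{k+1}\ge 0$. A map $f$ between metric spaces is a bi-Lipschitz embedding if $C_1d(x,y)\le d(f(x),f(y))\le C_2d(x,y)$ for all $x,y$ and some constants $C_1,C_2>0$; its distortion is the infimum of $C_2/C_1$ over all such pairs of constants. **Corollary.** (a) For every finite sequence $W=(w_r)_{r=0}^{M+1}$ of non-negative integers with $w_0=w_{M+1}=0$ there is a constant $C$ such that for every integer $\kappa\ge 1$, every real Banach space $X$ with an ESA basis and every $k\ge 1$, the graph $(T_{W,\kappa})^{\oslash^k}$ admits a bi-Lipschitz embedding into $X$ with distortion at most $C$. (Thus the family generated by a finitely branching bundle graph is equi-bi-Lipschitzly embeddable into any Banach space with an ESA basis, with a bound that depends neither on the space nor on the branching number.) (b) For every integer $\kappa\ge 1$,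 every $\kappa$-branching diamond graph, every $\kappa$-branching Laakso graph and every $\kappa$-branching parasol graph admits a bi-Lipschitz embedding into every real Banach space with an ESA basis with distortion at most $8$. -/

import Mathlib

/-! ### Top-bottom graphs, bundle graphs and the `⊘`-product -/

/-- A graph with two distinguished vertices, the `bottom` and the `top`. -/
structure TopBottomGraph where
  /-- the vertex set -/
  V : Type
  /-- the graph -/
  graph : SimpleGraph V
  /-- the bottom vertex -/
  bottom : V
  /-- the top vertex -/
  top : V
  bottom_ne_top : bottom ≠ top

/-- A finite sequence `W = (w_0, …, w_{M+1})` of natural numbers with `w_0 = w_{M+1} = 0`. -/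
structure DepthSequence where
  /-- the number of interior heights -/
  M : ℕ
  /-- the depth associated to each height -/
  w : Fin (M + 2) → ℕ
  w_zero : w 0 = 0
  w_last : w (Fin.last (M + 1)) = 0

/-- The `κ`-branching bundle graph `T_{W,κ}` associated with `W`. Its vertices are the pairs
`(r, A)` with `0 ≤ r ≤ M + 1` and `A` a sequence in `κ` of length `w_r`; the vertices `(r, A)` and
`(s, B)` are adjacent when `|r - s| = 1` and one of `A`, `B` is an initial segment of the other.
Only the cardinality of the type `κ` matters. -/
def bundleGraph (W : DepthSequence) (κ : Type) : TopBottomGraph where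
  V := {v : Fin (W.M + 2) × List κ // v.2.length = W.w v.1}
  graph :=
    { Adj := fun u v =>
        ((u.1.1 : ℕ) + 1 = v.1.1 ∨ (v.1.1 : ℕ) + 1 = u.1.1) ∧
          (u.1.2 <+: v.1.2 ∨ v.1.2 <+: u.1.2)
      symm := ⟨fun _ _ h => ⟨h.1.symm, h.2.symm⟩⟩
      loopless := ⟨fun u h => by have := h.1; omega⟩ }
  bottom := ⟨(0, []), by simp [W.w_zero]⟩
  top := ⟨(Fin.last (W.M + 1), []), by simp [W.w_last]⟩
  bottom_ne_top := by
    intro h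
    have h1 := congrArg (fun v => ((v.1.1 : Fin (W.M + 2)) : ℕ)) h
    simp at h1

namespace TopBottomGraph

/-- The height of a vertex is its distance from the bottom. -/
noncomputable def height (G : TopBottomGraph) (v : G.V) : ℕ :=
  G.graph.dist G.bottom v

/-- The edges of `G`, each written as the pair (lower endpoint, higher endpoint). In a bundle graph
the heights of adjacent vertices differ by exactly one, so every edge occurs exactly once. -/
def UpEdge (G : TopBottomGraph) : Type :=
  {e : G.V × G.V // G.graph.Adj e.1 e.2 ∧ G.height e.2 = G.height e.1 + 1}

/-- The lower endpoint of an edge. -/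
def UpEdge.lower {G : TopBottomGraph} (e : G.UpEdge) : G.V := e.1.1

/-- The higher endpoint of an edge. -/
def UpEdge.upper {G : TopBottomGraph} (e : G.UpEdge) : G.V := e.1.2

/-- The vertices of `H` other than its bottom and its top. -/
def Inner (H : TopBottomGraph) : Type :=
  {x : H.V // x ≠ H.bottom ∧ x ≠ H.top}

/-- The edges of `G ⊘ H` (up to symmetry): inside the copy of `H` that replaces the edge `e` of `G`,
the bottom of `H` is the lower endpoint of `e` and the top of `H` is its higher endpoint. -/
inductive OslashRel (G H : TopBottomGraph) :
    G.V ⊕ (G.UpEdge × H.Inner) → G.V ⊕ (G.UpEdge × H.Inner) → Prop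
  | bottom_top (e : G.UpEdge) (h : H.graph.Adj H.bottom H.top) :
      OslashRel G H (Sum.inl e.lower) (Sum.inl e.upper)
  | bottom_inner (e : G.UpEdge) (x : H.Inner) (h : H.graph.Adj H.bottom x.1) :
      OslashRel G H (Sum.inl e.lower) (Sum.inr (e, x))
  | inner_top (e : G.UpEdge) (x : H.Inner) (h : H.graph.Adj x.1 H.top) :
      OslashRel G H (Sum.inr (e, x)) (Sum.inl e.upper)
  | inner_inner (e : G.UpEdge) (x y : H.Inner) (h : H.graph.Adj x.1 y.1) :
      OslashRel G H (Sum.inr (e, x)) (Sum.inr (e, y))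

/-- The product `G ⊘ H`: every edge of `G` is replaced with a copy of `H`. -/
def oslash (G H : TopBottomGraph) : TopBottomGraph where
  V := G.V ⊕ (G.UpEdge × H.Inner)
  graph := SimpleGraph.fromRel (OslashRel G H)
  bottom := Sum.inl G.bottom
  top := Sum.inl G.top
  bottom_ne_top := fun h => G.bottom_ne_top (Sum.inl.inj h)

/-- The family of graphs generated by `G`: `G.generated k` is the `(k + 1)`-st power of `G`, that is,
`G.generated 0 = G` and `G.generated (k + 1) = (G.generated k) ⊘ G`. -/
def generated (G : TopBottomGraph) : ℕ → TopBottomGraph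
  | 0 => G
  | k + 1 => (G.generated k).oslash G

end TopBottomGraph

/-- The sequence `(0, 1, 0)`, which generates the diamond graphs. -/
def diamondSequence : DepthSequence where
  M := 1
  w := ![0, 1, 0]
  w_zero := rfl
  w_last := rfl

/-- The sequence `(0, 0, 1, 0, 0)`, which generates the Laakso graphs. -/
def laaksoSequence : DepthSequence where
  M := 3
  w := ![0, 0, 1, 0, 0]
  w_zero := rfl
  w_last := rfl

/-- The sequence `(0, 0, 1, 0)`, which generates the parasol graphs. -/
def parasolSequence : DepthSequence where
  M := 2
  w := ![0, 0, 1, 0]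
  w_zero := rfl
  w_last := rfl

/-! ### Equal-signs-additive bases -/

/-- A sequence `e` in `X` is equal-signs-additive if for every finitely supported real sequence `a`
and every `k` with `a_k a_{k+1} ≥ 0`, the vectors
`∑_{n<k} a_n e_n + (a_k + a_{k+1}) e_k + ∑_{n≥k+2} a_n e_n` and `∑_n a_n e_n` have the same norm. -/
def IsESA {X : Type*} [NormedAddCommGroup X] [NormedSpace ℝ X] (e : ℕ → X) : Prop :=
  ∀ (a : ℕ →₀ ℝ) (k : ℕ), 0 ≤ a k * a (k + 1) →
    ‖∑ n ∈ Finset.range k, a n • e n + (a k + a (k + 1)) • e k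
        + ∑ n ∈ a.support.filter (fun n => k + 2 ≤ n), a n • e n‖
      = ‖∑ n ∈ a.support, a n • e n‖

/-- `X` has a (Schauder) basis that is equal-signs-additive. -/
def HasESABasis (X : Type*) [NormedAddCommGroup X] [NormedSpace ℝ X] : Prop :=
  ∃ b : SchauderBasis ℝ X, IsESA (fun n => b n)

/-! ### Bi-Lipschitz embeddings of graphs with the shortest-path metric -/

/-- `C₁ d(u, v) ≤ d_X(f u, f v) ≤ C₂ d(u, v)` for all vertices `u`, `v`, where `d` is the
shortest-path metric. -/
def IsBiLipschitzWith {V X : Type*} [MetricSpace X] (G : SimpleGraph V) (f : V → X)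
    (C₁ C₂ : ℝ) : Prop :=
  ∀ u v : V, C₁ * (G.dist u v : ℝ) ≤ dist (f u) (f v) ∧ dist (f u) (f v) ≤ C₂ * (G.dist u v : ℝ)

/-- `f` is a bi-Lipschitz embedding. -/
def IsBiLipschitzEmbedding {V X : Type*} [MetricSpace X] (G : SimpleGraph V) (f : V → X) : Prop :=
  ∃ C₁ C₂ : ℝ, 0 < C₁ ∧ 0 < C₂ ∧ IsBiLipschitzWith G f C₁ C₂

/-- The distortion of a bi-Lipschitz embedding `f`: the infimum of `C₂ / C₁` over all admissible
constants. -/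
noncomputable def distortion {V X : Type*} [MetricSpace X] (G : SimpleGraph V) (f : V → X) : ℝ :=
  sInf {c : ℝ | ∃ C₁ C₂ : ℝ, 0 < C₁ ∧ 0 < C₂ ∧ IsBiLipschitzWith G f C₁ C₂ ∧ c = C₂ / C₁}

/-- The graph `G` is bi-Lipschitzly embeddable into `X` with distortion at most `D`. -/
def EmbedsWithDistortionLE (G : TopBottomGraph) (X : Type*) [MetricSpace X] (D : ℝ) : Prop :=
  ∃ f : G.V → X, IsBiLipschitzEmbedding G.graph f ∧ distortion G.graph f ≤ D

/-! Every power of a bundle graph is described by a depth function `w` on the heights `0, …, N`: a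
vertex is a height `r` with a sequence of length `w r`, and adjacency means consecutive heights and
comparable sequences (`IsCoding.oslash`). It suffices to embed such coded graphs.

The heights `t` with `w t ≤ p` cut `[0, N)` into cells of level `p`, refined as `p` grows. Attach an
orientation bit to every prefix of a branch. The bits along a branch permute `[0, N)`: inside each
cell the subcells of the next level keep their order or are reversed. Since `[0, r)` is a union of
cells of level `w r`, its image depends only on the bits up to that level, hence only on the vertex.
The vertex is sent to the sum, over all `n` assignments of bits, of the indicator of this image in
one block of basis vectors minus its copy in the next block.

For an ESA sequence, spreading coefficients preserves the norm and monotone merging does not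
increase it (`IsESA.norm_mapDomain_le`). Crossing an edge changes the image by a spread copy of
`altVec n`, so the map is Lipschitz with constant `altNorm e n`. For the lower bound, merging each
block to a point gives the height difference times `altNorm e n`, which suffices when the distance
is the height difference. Otherwise both heights lie in one cell of the level at which the branches
split. At least a `4 ^ (-m)` part of the assignments preserves the order on the next `m` levels
along one branch and reverses it along the other. For these, the numbers of points moved into the
first `q` places of the cell differ by a known amount, large enough for one of the two choices of
roles, and merging leaves this amount times an alternating sum of at least `n / 4 ^ m` pairs.

A suitable `q`, at least a `K`-th part of the cell, comes from `HasSymmetricCuts`. This property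
passes to `⊘` with the same `m` and `K`, so the bound `4 ^ m * K` depends on neither the power, the
branching number nor the space. -/

/-! ### Spreading and merging coefficients of an ESA sequence -/

open Finset in
/-- Replacing `(a k, a (k + 1))` with `(a k + a (k + 1), 0)` when the signs agree. -/
theorem IsESA.norm_absorb_succ {X : Type*} [NormedAddCommGroup X] [NormedSpace ℝ X] {e : ℕ → X}
    (he : IsESA e) (y : ℕ →₀ ℝ) (k : ℕ) (hk : y k = 0) (hk' : y (k + 1) = 0) (c d : ℝ)
    (h : 0 ≤ c * d) :
    ‖Finsupp.linearCombination ℝ e (y + Finsupp.single k c + Finsupp.single (k + 1) d)‖ =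
      ‖Finsupp.linearCombination ℝ e (y + Finsupp.single k (c + d))‖ := by
  classical
  set a : ℕ →₀ ℝ := y + Finsupp.single k c + Finsupp.single (k + 1) d with ha
  have hak : a k = c := by simp [ha, hk]
  have hak' : a (k + 1) = d := by simp [ha, hk']
  have hT : Finsupp.linearCombination ℝ e a = ∑ n ∈ a.support, a n • e n := by
    rw [Finsupp.linearCombination_apply, Finsupp.sum]
  have hsplit := sum_filter_add_sum_filter_not a.support (fun n => k + 2 ≤ n)
    (fun n => a n • e n)
  have hlow : ∑ n ∈ a.support.filter (fun n => ¬ k + 2 ≤ n), a n • e n =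
      ∑ n ∈ range (k + 2), a n • e n := by
    refine sum_subset (fun n hn => ?_) (fun n hn hn' => ?_)
    · simp only [mem_filter, mem_range] at hn ⊢; omega
    · have : a n = 0 := by
        by_contra h0
        simp only [mem_filter, mem_range, Finsupp.mem_support_iff] at hn hn'
        exact hn' ⟨h0, by omega⟩
      simp [this]
  have hval := he a k (by rw [hak, hak']; exact h)
  rw [hT, ← hval]
  congr 1
  have hy : Finsupp.linearCombination ℝ e (y + Finsupp.single k (c + d)) =
      Finsupp.linearCombination ℝ e a + d • e k - d • e (k + 1) := by
    simp only [ha, map_add, Finsupp.linearCombination_single, add_smul]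
    abel
  rw [hy, hT, ← hsplit, hlow, sum_range_succ, sum_range_succ, hak, hak', add_smul]
  abel

/-- The places in between carry zero, so the right coefficient walks left one place at a time, each
move being an absorption into a zero coefficient. -/
theorem IsESA.norm_absorb {X : Type*} [NormedAddCommGroup X] [NormedSpace ℝ X] {e : ℕ → X}
    (he : IsESA e) (y : ℕ →₀ ℝ) (P d : ℕ) (hy : ∀ k, P ≤ k → k ≤ P + d + 1 → y k = 0) (b c : ℝ)
    (h : 0 ≤ b * c) :
    ‖Finsupp.linearCombination ℝ e (y + Finsupp.single P b + Finsupp.single (P + d + 1) c)‖ =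
      ‖Finsupp.linearCombination ℝ e (y + Finsupp.single P (b + c))‖ := by
  induction d with
  | zero => exact he.norm_absorb_succ y P (hy _ le_rfl (by omega)) (hy _ (by omega) le_rfl) b c h
  | succ d ih =>
    rw [← ih (fun k h1 h2 => hy k h1 (by omega))]
    have := he.norm_absorb_succ (y + Finsupp.single P b) (P + d + 1)
      (by rw [Finsupp.add_apply, hy _ (by omega) (by omega), Finsupp.single_eq_of_ne (by omega),
        add_zero])
      (by rw [Finsupp.add_apply, hy _ (by omega) (by omega), Finsupp.single_eq_of_ne (by omega),
        add_zero]) 0 c (by simp)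
    simpa [← add_assoc] using this

open Finset in
/-- Moving the coefficients of an ESA sequence along a monotone map that merges only coefficients
of equal signs does not change the norm. -/
theorem IsESA.norm_mapDomain_of_sign {X : Type*} [NormedAddCommGroup X] [NormedSpace ℝ X]
    {e : ℕ → X} (he : IsESA e) (a : ℕ →₀ ℝ) (φ : ℕ → ℕ) (hφ : Monotone φ)
    (h : ∀ i j, φ i = φ j → 0 ≤ a i * a j) :
    ‖Finsupp.linearCombination ℝ e (a.mapDomain φ)‖ = ‖Finsupp.linearCombination ℝ e a‖ := by
  classical
  obtain ⟨n, hn⟩ : ∃ n, a.support ⊆ range n := a.support.exists_nat_subset_range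
  -- A common normal form: all coefficients are parked far to the right at `B + j` and brought to `ψ
  -- j` one by one, from the left. Using it for `φ` and for the identity compares the two norms.
  have key : ∀ (ψ : ℕ → ℕ), Monotone ψ → (∀ i j, ψ i = ψ j → 0 ≤ a i * a j) → ∀ B, ψ n < B →
      ∀ i ≤ n, ‖Finsupp.linearCombination ℝ e (∑ j ∈ range i, Finsupp.single (ψ j) (a j) +
        ∑ j ∈ Ico i n, Finsupp.single (B + j) (a j))‖ =
        ‖Finsupp.linearCombination ℝ e (∑ j ∈ range n, Finsupp.single (B + j) (a j))‖ := by
    intro ψ hψ hs B hB i hi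
    induction i with
    | zero => simp
    | succ i ih =>
      rw [← ih (by omega)]
      have hi' : ψ i < B := (hψ (show i ≤ n by omega)).trans_lt hB
      set y : ℕ →₀ ℝ := ∑ j ∈ (range i).filter (fun j => ¬ ψ j = ψ i), Finsupp.single (ψ j) (a j) +
        ∑ j ∈ Ico (i + 1) n, Finsupp.single (B + j) (a j) with hy
      set b : ℝ := ∑ j ∈ (range i).filter (fun j => ψ j = ψ i), a j with hb
      have hb' : ∑ j ∈ (range i).filter (fun j => ψ j = ψ i), Finsupp.single (ψ j) (a j) =
          Finsupp.single (ψ i) b := by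
        rw [hb, Finsupp.single_finsetSum]
        exact sum_congr rfl fun j hj => by rw [(mem_filter.1 hj).2]
      have hsplit := sum_filter_add_sum_filter_not (range i) (fun j => ψ j = ψ i)
        (fun j => Finsupp.single (ψ j) (a j))
      obtain ⟨d, hd⟩ : ∃ d, B + i = ψ i + d + 1 := ⟨B + i - ψ i - 1, by omega⟩
      have hab := he.norm_absorb y (ψ i) d (fun k h1 h2 => ?_) b (a i) ?_
      · rw [sum_range_succ, ← hsplit, hb', sum_eq_sum_Ico_succ_bot (show i < n by omega), hd]
        convert hab.symm using 3
        · rw [hy, Finsupp.single_add]; abel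
        · rw [hy]; abel
      · rw [hy, Finsupp.add_apply, Finsupp.finsetSum_apply, Finsupp.finsetSum_apply,
          sum_eq_zero, sum_eq_zero, add_zero]
        · intro j hj
          rw [mem_Ico] at hj
          rw [Finsupp.single_eq_of_ne]; omega
        · intro j hj
          rw [mem_filter, mem_range] at hj
          have := hψ hj.1.le
          rw [Finsupp.single_eq_of_ne]; omega
      · rw [hb, sum_mul]
        exact sum_nonneg fun j hj => hs _ _ (mem_filter.1 hj).2
  have hsum : a = ∑ j ∈ range n, Finsupp.single j (a j) := by
    conv_lhs => rw [← Finsupp.sum_single a]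
    exact Finsupp.sum_of_support_subset _ hn _ (by simp)
  have hmap : a.mapDomain φ = ∑ j ∈ range n, Finsupp.single (φ j) (a j) := by
    conv_lhs => rw [hsum]
    rw [Finsupp.mapDomain_finsetSum]
    simp [Finsupp.mapDomain_single]
  have h1 := key φ hφ h (φ n + n + 1) (by omega) n le_rfl
  have h2 := key id monotone_id (fun i j hij => by
    simp only [id] at hij; subst hij; exact mul_self_nonneg _) (φ n + n + 1)
    (by simp only [id]; omega) n le_rfl
  simp only [Ico_self, sum_empty, add_zero, id] at h1 h2
  rw [hmap, h1, ← h2, ← hsum]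

theorem IsESA.norm_mapDomain_of_strictMono {X : Type*} [NormedAddCommGroup X] [NormedSpace ℝ X]
    {e : ℕ → X} (he : IsESA e) (a : ℕ →₀ ℝ) (φ : ℕ → ℕ) (hφ : StrictMono φ) :
    ‖Finsupp.linearCombination ℝ e (a.mapDomain φ)‖ = ‖Finsupp.linearCombination ℝ e a‖ :=
  he.norm_mapDomain_of_sign a φ hφ.monotone fun i j hij => by
    rw [hφ.injective hij]; exact mul_self_nonneg _

theorem IsESA.norm_eq {X : Type*} [NormedAddCommGroup X] [NormedSpace ℝ X]
    {e : ℕ → X} (he : IsESA e) (k : ℕ) : ‖e k‖ = ‖e 0‖ := by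
  have := he.norm_mapDomain_of_strictMono (Finsupp.single 0 1) (fun i => i + k)
    (fun i j h => by simpa using h)
  simpa [Finsupp.mapDomain_single] using this

-- The sum telescopes in `j`, one shift costing two boundary terms. The bound is independent of `K`,
-- which makes the averaging below work.
open Finset in
theorem norm_sum_shift_sub_le {X : Type*} [NormedAddCommGroup X] (g : ℕ → X) (E : ℝ)
    (hg : ∀ i, ‖g i‖ ≤ E) (K j : ℕ) :
    ‖∑ l ∈ range K, (g (l + j) - g l)‖ ≤ j * (2 * E) := by
  induction j with
  | zero => simp
  | succ j ih =>
    have h1 : ∑ l ∈ range K, (g (l + (j + 1)) - g l) =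
        (∑ l ∈ range K, (g (l + j) - g l)) + (g (K + j) - g j) := by
      have := sum_range_sub (fun l => g (l + j)) K
      simp only [zero_add] at this
      rw [← this, ← sum_add_distrib]
      refine sum_congr rfl fun l _ => ?_
      rw [show l + (j + 1) = l + 1 + j by ring]
      abel
    rw [h1]
    refine (norm_add_le _ _).trans ?_
    have := (norm_sub_le (g (K + j)) (g j)).trans (add_le_add (hg _) (hg _))
    push_cast
    linarith

open Finset in
/-- Moving the coefficients of an ESA sequence along a monotone map does not increase the norm. -/
theorem IsESA.norm_mapDomain_le {X : Type*} [NormedAddCommGroup X] [NormedSpace ℝ X]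
    {e : ℕ → X} (he : IsESA e) (a : ℕ →₀ ℝ) (φ : ℕ → ℕ) (hφ : Monotone φ) :
    ‖Finsupp.linearCombination ℝ e (a.mapDomain φ)‖ ≤ ‖Finsupp.linearCombination ℝ e a‖ := by
  classical
  set T := Finsupp.linearCombination ℝ e with hT
  set s := a.mapDomain φ with hs
  set R : ℝ := ∑ j ∈ a.support, |a j| * (j * (2 * ‖e 0‖)) with hR
  -- Averaging: `A` consists of `K` strictly increasing spreads of `a`. `A'` repeats each
  -- coefficient of the merged vector `K` times, so its norm is exactly `K * ‖T s‖`. They differ by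
  -- shifts by `j`, whose total cost `R` disappears after division by `K`.
  have key : ∀ K : ℕ, 0 < K → ‖T s‖ ≤ ‖T a‖ + R / K := by
    intro K hK
    have hK' : (0 : ℝ) < K := by exact_mod_cast hK
    set A : ℕ →₀ ℝ := ∑ l ∈ range K, a.mapDomain (fun j => φ j * K + (j + l)) with hA
    set A' : ℕ →₀ ℝ := ∑ l ∈ range K, s.mapDomain (fun v => v * K + l) with hA'
    have hAn : ‖T A‖ ≤ K * ‖T a‖ := by
      rw [hA, map_sum]
      refine (norm_sum_le _ _).trans ?_
      rw [sum_congr rfl fun l _ => he.norm_mapDomain_of_strictMono a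
        (fun j => φ j * K + (j + l)) ?_]
      · simp [hT]
      · intro i j hij
        have := Nat.mul_le_mul_right K (hφ hij.le)
        change φ i * K + (i + l) < φ j * K + (j + l)
        omega
    have hA'apply : ∀ x, A' x = s (x / K) := by
      intro x
      have hx : x = x / K * K + x % K := by rw [mul_comm]; exact (Nat.div_add_mod x K).symm
      rw [hA', Finsupp.finsetSum_apply, sum_eq_single (x % K)]
      · have hinj : Function.Injective (fun v => v * K + x % K) := fun v v' h =>
          Nat.eq_of_mul_eq_mul_right hK (Nat.add_right_cancel h)
        have := Finsupp.mapDomain_apply hinj s (x / K)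
        rwa [← hx] at this
      · intro l hl hne
        refine Finsupp.mapDomain_of_notMem_range _ _ ?_
        rintro ⟨v, rfl⟩
        apply hne
        change l = (v * K + l) % K
        rw [Nat.mul_add_mod_self_right, Nat.mod_eq_of_lt (mem_range.1 hl)]
      · intro h; exact absurd (mem_range.2 (Nat.mod_lt _ hK)) h
    have hA'n : ‖T A'‖ = K * ‖T s‖ := by
      have h1 := he.norm_mapDomain_of_sign A' (fun x => x / K)
        (fun x y h => Nat.div_le_div_right h) (fun i j hij => by
          rw [hA'apply, hA'apply, hij]; exact mul_self_nonneg _)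
      have h2 : A'.mapDomain (fun x => x / K) = (K : ℝ) • s := by
        rw [hA', Finsupp.mapDomain_finsetSum, sum_congr rfl fun l hl => (?_ : _ = s)]
        · rw [sum_const, card_range, Nat.cast_smul_eq_nsmul]
        · rw [← Finsupp.mapDomain_comp]
          have : (fun x => x / K) ∘ (fun v => v * K + l) = id := by
            ext v
            simp only [Function.comp, id]
            rw [mul_comm, Nat.mul_add_div hK, Nat.div_eq_of_lt (mem_range.1 hl), add_zero]
          rw [this, Finsupp.mapDomain_id]
      rw [hT, ← h1, h2, map_smul, norm_smul, Real.norm_natCast]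
    have hdiff : ‖T A - T A'‖ ≤ R := by
      have : T A - T A' = ∑ j ∈ a.support, a j • ∑ l ∈ range K,
          ((fun i => e (φ j * K + i)) (l + j) - (fun i => e (φ j * K + i)) l) := by
        have e1 : ∀ ψ : ℕ → ℕ, T (a.mapDomain ψ) = ∑ j ∈ a.support, a j • e (ψ j) := by
          intro ψ
          rw [hT, Finsupp.linearCombination_mapDomain, Finsupp.linearCombination_apply,
            Finsupp.sum]
          rfl
        rw [hA, hA', map_sum, map_sum, ← sum_sub_distrib]
        simp_rw [smul_sum]
        rw [sum_comm]
        refine sum_congr rfl fun l _ => ?_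
        rw [hs, ← Finsupp.mapDomain_comp, e1, e1, ← sum_sub_distrib]
        refine sum_congr rfl fun j _ => ?_
        rw [smul_sub]
        simp only [Function.comp, add_comm]
      rw [this, hR]
      refine (norm_sum_le _ _).trans (sum_le_sum fun j _ => ?_)
      rw [norm_smul, Real.norm_eq_abs]
      exact mul_le_mul_of_nonneg_left
        (norm_sum_shift_sub_le _ _ (fun i => (he.norm_eq _).le) K j) (abs_nonneg _)
    have h3 : K * ‖T s‖ ≤ K * ‖T a‖ + R := by
      rw [← hA'n]
      have : T A' = T A - (T A - T A') := by abel
      rw [this]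
      exact (norm_sub_le _ _).trans (add_le_add hAn hdiff)
    have h4 : ‖T a‖ + R / K = (K * ‖T a‖ + R) / K := by field_simp
    rw [h4, le_div_iff₀ hK']
    linarith
  have hlim : Filter.Tendsto (fun K : ℕ => ‖T a‖ + R / K) Filter.atTop (nhds (‖T a‖ + 0)) :=
    tendsto_const_nhds.add (tendsto_const_div_atTop_nhds_zero_nat R)
  rw [add_zero] at hlim
  exact ge_of_tendsto hlim (Filter.eventually_atTop.2 ⟨1, fun K hK => key K hK⟩)

/-! ### Norms of alternating sums -/

/-- The vector `∑_{j < n} (e_{2j} - e_{2j+1})`. -/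
noncomputable def altVec (n : ℕ) : ℕ →₀ ℝ :=
  ∑ j ∈ Finset.range n, (Finsupp.single (2 * j) 1 - Finsupp.single (2 * j + 1) 1)

/-- The norm of `∑_{j < n} (e_{2j} - e_{2j+1})`. -/
noncomputable def altNorm {X : Type*} [NormedAddCommGroup X] [NormedSpace ℝ X] (e : ℕ → X)
    (n : ℕ) : ℝ :=
  ‖Finsupp.linearCombination ℝ e (altVec n)‖

theorem mapDomain_sub_real (φ : ℕ → ℕ) (a b : ℕ →₀ ℝ) :
    (a - b).mapDomain φ = a.mapDomain φ - b.mapDomain φ :=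
  map_sub (Finsupp.mapDomain.addMonoidHom φ : (ℕ →₀ ℝ) →+ (ℕ →₀ ℝ)) a b

theorem mapDomain_altVec (φ : ℕ → ℕ) (n : ℕ) :
    (altVec n).mapDomain φ = ∑ j ∈ Finset.range n,
      (Finsupp.single (φ (2 * j)) (1 : ℝ) - Finsupp.single (φ (2 * j + 1)) 1) := by
  simp only [altVec, Finsupp.mapDomain_finsetSum, mapDomain_sub_real, Finsupp.mapDomain_single]

theorem IsESA.altNorm_mono {X : Type*} [NormedAddCommGroup X] [NormedSpace ℝ X] {e : ℕ → X}
    (he : IsESA e) : Monotone (altNorm e) := by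
  refine monotone_nat_of_le_succ fun n => ?_
  -- This merging sends the last pair to a single place, where it cancels.
  have h := he.norm_mapDomain_le (altVec (n + 1)) (fun i => min i (2 * n))
    (fun i j hij => min_le_min_right _ hij)
  rw [mapDomain_altVec, Finset.sum_range_succ] at h
  have h0 : min (2 * n) (2 * n) = min (2 * n + 1) (2 * n) := by omega
  rw [h0, sub_self, add_zero] at h
  refine le_of_eq_of_le ?_ h
  rw [altNorm, altVec]
  congr 2
  refine Finset.sum_congr rfl fun j hj => ?_
  have := Finset.mem_range.1 hj
  rw [min_eq_left (by omega), min_eq_left (by omega)]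

theorem IsESA.altNorm_add_le {X : Type*} [NormedAddCommGroup X] [NormedSpace ℝ X] {e : ℕ → X}
    (he : IsESA e) (m n : ℕ) : altNorm e (m + n) ≤ altNorm e m + altNorm e n := by
  have h := he.norm_mapDomain_of_strictMono (altVec n) (fun i => 2 * m + i)
    (fun i j hij => Nat.add_lt_add_left hij _)
  rw [mapDomain_altVec] at h
  have h2 : altVec (m + n) = altVec m + ∑ j ∈ Finset.range n,
      (Finsupp.single (2 * m + 2 * j) (1 : ℝ) - Finsupp.single (2 * m + (2 * j + 1)) 1) := by
    simp only [altVec, Finset.sum_range_add, mul_add, add_assoc]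
  rw [altNorm, h2, map_add]
  refine (norm_add_le _ _).trans_eq ?_
  rw [h]
  rfl

theorem IsESA.altNorm_mul_le {X : Type*} [NormedAddCommGroup X] [NormedSpace ℝ X] {e : ℕ → X}
    (he : IsESA e) (q b : ℕ) : altNorm e (q * b) ≤ q * altNorm e b := by
  induction q with
  | zero => simp [altNorm, altVec]
  | succ q ih =>
    rw [add_mul, one_mul]
    refine (he.altNorm_add_le _ _).trans ?_
    push_cast
    linarith

theorem IsESA.altNorm_pos {X : Type*} [NormedAddCommGroup X] [NormedSpace ℝ X] {e : ℕ → X}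
    (he : IsESA e) (hli : LinearIndependent ℝ e) {n : ℕ} (hn : 0 < n) : 0 < altNorm e n := by
  refine lt_of_lt_of_le ?_ (he.altNorm_mono (show 1 ≤ n from hn))
  simp only [altNorm, altVec, Finset.range_one, Finset.sum_singleton, map_sub,
    Finsupp.linearCombination_single, one_smul, norm_pos_iff, sub_ne_zero]
  exact hli.injective.ne (by norm_num)

open Finset in
theorem sum_filter_count {M : Type*} [AddCommMonoid M] (B : Finset ℕ) (g : ℕ → M) (n : ℕ) :
    ∑ j ∈ (range n).filter (· ∈ B), g (Nat.count (· ∈ B) j) =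
      ∑ i ∈ range (Nat.count (· ∈ B) n), g i := by
  induction n with
  | zero => simp
  | succ n ih =>
    rw [range_add_one, filter_insert, Nat.count_succ]
    split_ifs with h
    · rw [sum_insert (by simp), ih, sum_range_succ, add_comm]
    · rw [ih, add_zero]

/-! ### Hierarchical rearrangements of an interval -/

/-- The last `t ≤ h` with `w t ≤ p`. -/
def levelLo (w : ℕ → ℕ) (p h : ℕ) : ℕ := Nat.findGreatest (fun t => w t ≤ p) h

/-- The first `t > h` with `w t ≤ p`. -/
noncomputable def levelHi (w : ℕ → ℕ) (p h : ℕ) : ℕ := sInf {t | h < t ∧ w t ≤ p}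

section Levels

variable {w : ℕ → ℕ} {N p h h' t : ℕ}

theorem levelLo_le : levelLo w p h ≤ h := Nat.findGreatest_le h

theorem le_levelLo (hth : t ≤ h) (ht : w t ≤ p) : t ≤ levelLo w p h :=
  Nat.le_findGreatest (P := fun t => w t ≤ p) hth ht

theorem level_levelLo (hw : w 0 = 0) : w (levelLo w p h) ≤ p :=
  Nat.findGreatest_spec (P := fun t => w t ≤ p) (Nat.zero_le h) (by simp [hw])

theorem levelHi_le (hth : h < t) (ht : w t ≤ p) : levelHi w p h ≤ t := Nat.sInf_le ⟨hth, ht⟩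

theorem levelHi_spec (hw : w N = 0) (hh : h < N) :
    h < levelHi w p h ∧ w (levelHi w p h) ≤ p :=
  Nat.sInf_mem (s := {t | h < t ∧ w t ≤ p}) ⟨N, hh, by omega⟩

theorem levelLo_mono (hw : w 0 = 0) {q : ℕ} (hpq : p ≤ q) : levelLo w p h ≤ levelLo w q h :=
  le_levelLo levelLo_le ((level_levelLo hw).trans hpq)

theorem levelHi_anti (hw : w N = 0) (hh : h < N) {q : ℕ} (hpq : p ≤ q) :
    levelHi w q h ≤ levelHi w p h :=
  levelHi_le (levelHi_spec hw hh).1 ((levelHi_spec hw hh).2.trans hpq)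

/-- If no `t` with `h < t ≤ h'` has `w t ≤ p`, then `h` and `h'` lie in the same cell. -/
theorem level_eq_of_forall (hw : w 0 = 0) (hwN : w N = 0) (hh' : h' < N) (hle : h ≤ h')
    (H : ∀ t, h < t → t ≤ h' → p < w t) :
    levelLo w p h = levelLo w p h' ∧ levelHi w p h = levelHi w p h' := by
  have h1 := levelHi_spec (p := p) hwN (hle.trans_lt hh')
  have h2 := levelHi_spec (p := p) hwN hh'
  constructor
  · refine le_antisymm (le_levelLo (levelLo_le.trans hle) (level_levelLo hw))
      (le_levelLo ?_ (level_levelLo hw))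
    by_contra hcon
    have := H _ (not_le.1 hcon) levelLo_le
    have := level_levelLo (w := w) (p := p) (h := h') hw
    omega
  · refine le_antisymm (levelHi_le (by omega) h2.2) (levelHi_le ?_ h1.2)
    by_contra hcon
    have := H _ h1.1 (not_lt.1 hcon)
    omega

end Levels

/-- The left end of the interval which the rearrangement given by the orientations `b` assigns to
the `p`-th cell of `h`: passing from level `p` to level `p + 1`, the subcells of a cell are placed
in increasing or decreasing order according to `b (p + 1)`. -/
noncomputable def cellStart (w : ℕ → ℕ) (b : ℕ → Bool) : ℕ → ℕ → ℕ
  | 0, h => levelLo w 0 h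
  | p + 1, h => cellStart w b p h +
      if b (p + 1) then levelLo w (p + 1) h - levelLo w p h
      else levelHi w p h - levelHi w (p + 1) h

section Cells

variable {w : ℕ → ℕ} {N : ℕ} {b b' : ℕ → Bool}

theorem cellStart_congr {p : ℕ} (hb : ∀ i, 1 ≤ i → i ≤ p → b i = b' i) (h : ℕ) :
    cellStart w b p h = cellStart w b' p h := by
  induction p with
  | zero => rfl
  | succ p ih =>
    rw [cellStart, cellStart, ih fun i h1 h2 => hb i h1 (by omega), hb (p + 1) (by omega) le_rfl]

/-- Reordering subcells never leaves the interval assigned to the parent cell. -/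
theorem cellStart_nested (hw : w 0 = 0) (hwN : w N = 0) {h : ℕ} (hh : h < N) {p q : ℕ}
    (hpq : p ≤ q) :
    cellStart w b p h ≤ cellStart w b q h ∧
      cellStart w b q h + (levelHi w q h - levelLo w q h) ≤
        cellStart w b p h + (levelHi w p h - levelLo w p h) := by
  induction q, hpq using Nat.le_induction with
  | base => exact ⟨le_rfl, le_rfl⟩
  | succ q hpq ih =>
    have h1 := levelLo_mono (w := w) (h := h) hw (Nat.le_succ q)
    have h2 := levelHi_anti (w := w) hwN hh (Nat.le_succ q)
    have h3 := (levelHi_spec (w := w) (p := q + 1) hwN hh).1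
    have h4 := levelLo_le (w := w) (p := q + 1) (h := h)
    simp only [Nat.succ_eq_add_one] at h1 h2
    rw [cellStart]
    split_ifs <;> omega

theorem cellStart_eq_of_forall (hw : w 0 = 0) (hwN : w N = 0) {p h h' : ℕ} (hh' : h' < N)
    (hle : h ≤ h') (H : ∀ t, h < t → t ≤ h' → p < w t) :
    cellStart w b p h = cellStart w b p h' := by
  induction p with
  | zero => exact (level_eq_of_forall hw hwN hh' hle H).1
  | succ p ih =>
    have h1 := level_eq_of_forall hw hwN hh' hle H
    have h2 := level_eq_of_forall (p := p) hw hwN hh' hle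
      fun t ht ht' => (Nat.lt_succ_self p).trans (H t ht ht')
    rw [cellStart, cellStart, ih fun t ht ht' => (Nat.lt_succ_self p).trans (H t ht ht'), h1.1,
      h1.2, h2.1, h2.2]

/-- Different cells occupy disjoint intervals. -/
theorem cellStart_disjoint (hw : w 0 = 0) (hwN : w N = 0) {p h h' t : ℕ} (hh' : h' < N)
    (ht : h < t) (ht' : t ≤ h') (hwt : w t ≤ p) :
    cellStart w b p h + (levelHi w p h - levelLo w p h) ≤ cellStart w b p h' ∨
      cellStart w b p h' + (levelHi w p h' - levelLo w p h') ≤ cellStart w b p h := by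
  have hh : h < N := by omega
  induction p generalizing t with
  | zero =>
    left
    have h1 := levelHi_le ht hwt
    have h2 := le_levelLo ht' hwt
    have h3 := levelLo_le (w := w) (p := 0) (h := h)
    have h4 := levelHi_spec (w := w) (p := 0) hwN hh
    simp only [cellStart]
    omega
  | succ p ih =>
    have n1 := cellStart_nested (b := b) hw hwN hh (Nat.le_succ p)
    have n2 := cellStart_nested (b := b) hw hwN hh' (Nat.le_succ p)
    -- Either the parent cells already differ, and nesting suffices, or both subcells lie in one
    -- parent and the orientation at `p + 1` orders them.
    by_cases H : ∃ s, h < s ∧ s ≤ h' ∧ w s ≤ p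
    · obtain ⟨s, hs, hs', hws⟩ := H
      have := ih hs hs' hws
      simp only [Nat.succ_eq_add_one] at n1 n2
      omega
    · push Not at H
      have e1 := cellStart_eq_of_forall (b := b) hw hwN hh' (ht.le.trans ht') H
      have e2 := level_eq_of_forall hw hwN hh' (ht.le.trans ht') H
      have h1 := levelHi_le ht hwt
      have h2 := le_levelLo ht' hwt
      have h3 := levelLo_le (w := w) (p := p + 1) (h := h)
      have h4 := levelHi_spec (w := w) (p := p + 1) hwN hh
      have h3' := levelLo_le (w := w) (p := p + 1) (h := h')
      have h4' := levelHi_spec (w := w) (p := p + 1) hwN hh'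
      have m1 := levelLo_mono (w := w) (h := h) hw (Nat.le_succ p)
      have m2 := levelHi_anti (w := w) hwN hh (Nat.le_succ p)
      have m1' := levelLo_mono (w := w) (h := h') hw (Nat.le_succ p)
      have m2' := levelHi_anti (w := w) hwN hh' (Nat.le_succ p)
      simp only [Nat.succ_eq_add_one] at m1 m2 m1' m2'
      rw [cellStart, cellStart, e1]
      split_ifs <;> omega

theorem cellStart_zero_add_le (hw : w 0 = 0) (hwN : w N = 0) {h : ℕ} (hh : h < N) (q : ℕ) :
    cellStart w b q h + (levelHi w q h - levelLo w q h) ≤ N := by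
  have h1 := (cellStart_nested (b := b) hw hwN hh (Nat.zero_le q)).2
  have h2 := levelHi_le (p := 0) hh hwN.le
  have h3 := levelLo_le (w := w) (p := 0) (h := h)
  have h4 := levelHi_spec (w := w) (p := 0) hwN hh
  simp only [cellStart] at h1
  omega

/-- The cells of maximal level are single points. -/
theorem level_of_top {D : ℕ} (hD : ∀ t ≤ N, w t ≤ D) {h : ℕ} (hh : h < N) (hwN : w N = 0) :
    levelLo w D h = h ∧ levelHi w D h = h + 1 :=
  ⟨le_antisymm levelLo_le (le_levelLo le_rfl (hD h hh.le)),
    le_antisymm (levelHi_le (Nat.lt_succ_self h) (hD _ hh)) (levelHi_spec hwN hh).1⟩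

theorem cellStart_injOn (hw : w 0 = 0) (hwN : w N = 0) {D : ℕ} (hD : ∀ t ≤ N, w t ≤ D) :
    Set.InjOn (cellStart w b D) (Finset.range N : Set ℕ) := by
  have key : ∀ h h', h < h' → h' < N → cellStart w b D h ≠ cellStart w b D h' := by
    intro h h' hlt hh'
    have h1 := cellStart_disjoint (b := b) hw hwN hh' hlt le_rfl (hD h' hh'.le)
    have h2 := level_of_top hD hh' hwN
    have h3 := level_of_top hD (hlt.trans hh') hwN
    omega
  intro h hh h' hh' heq
  simp only [Finset.coe_range, Set.mem_Iio] at hh hh'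
  rcases lt_trichotomy h h' with hlt | rfl | hlt
  · exact absurd heq (key _ _ hlt hh')
  · rfl
  · exact absurd heq.symm (key _ _ hlt hh)

theorem cellStart_lt (hw : w 0 = 0) (hwN : w N = 0) {h : ℕ} (hh : h < N) (D : ℕ) :
    cellStart w b D h < N := by
  have h1 := cellStart_zero_add_le (b := b) hw hwN hh D
  have h3 := levelLo_le (w := w) (p := D) (h := h)
  have h4 := levelHi_spec (w := w) (p := D) hwN hh
  omega

open Finset in
theorem image_cellStart_range (hw : w 0 = 0) (hwN : w N = 0) {D : ℕ} (hD : ∀ t ≤ N, w t ≤ D) :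
    (range N).image (cellStart w b D) = range N := by
  refine eq_of_subset_of_card_le ?_ ?_
  · intro x hx
    obtain ⟨h, hh, rfl⟩ := mem_image.1 hx
    exact mem_range.2 (cellStart_lt hw hwN (mem_range.1 hh) D)
  · rw [card_image_of_injOn (cellStart_injOn hw hwN hD)]

open Finset in
/-- The set occupied by `[0, t)` depends only on the orientations of levels at most `w t`. -/
theorem image_cellStart_congr (hw : w 0 = 0) (hwN : w N = 0) {D : ℕ} (hD : ∀ t ≤ N, w t ≤ D)
    {t : ℕ} (ht : t ≤ N) (hb : ∀ i, 1 ≤ i → i ≤ w t → b i = b' i) :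
    (range t).image (cellStart w b D) = (range t).image (cellStart w b' D) := by
  have key : ∀ b b' : ℕ → Bool, (∀ i, 1 ≤ i → i ≤ w t → b i = b' i) →
      (range t).image (cellStart w b D) ⊆ (range t).image (cellStart w b' D) := by
    intro b b' hb x hx
    obtain ⟨h, hh, rfl⟩ := mem_image.1 hx
    rw [mem_range] at hh
    have hhN : h < N := hh.trans_le ht
    have hmem : cellStart w b D h ∈ (range N).image (cellStart w b' D) := by
      rw [image_cellStart_range hw hwN hD]
      exact mem_range.2 (cellStart_lt hw hwN hhN D)
    obtain ⟨h', hh', heq⟩ := mem_image.1 hmem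
    rw [mem_range] at hh'
    refine mem_image.2 ⟨h', mem_range.2 ?_, heq⟩
    -- If `h < t ≤ h'`, the cells of level `w t` containing them occupy disjoint intervals, which
    -- are the same for `b` and `b'`; yet both would contain the common position.
    by_contra hcon
    have hd := cellStart_disjoint (b := b) hw hwN hh' hh (not_lt.1 hcon) le_rfl
    have n1 := cellStart_nested (b := b) hw hwN hhN (hD t ht)
    have n2 := cellStart_nested (b := b') hw hwN hh' (hD t ht)
    have l1 := level_of_top hD hhN hwN
    have l2 := level_of_top hD hh' hwN
    rw [← cellStart_congr (b := b) hb] at n2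
    omega
  exact (key b b' hb).antisymm (key b' b fun i h1 h2 => (hb i h1 h2).symm)

end Cells

/-! ### First places of a cell under constant orientations -/

section Order

variable {w : ℕ → ℕ} {N : ℕ} {b b' : ℕ → Bool}

theorem cellStart_add_of_true (hw : w 0 = 0) {p h i : ℕ}
    (hb : ∀ j, p < j → j ≤ p + i → b j = true) :
    cellStart w b (p + i) h + levelLo w p h = cellStart w b p h + levelLo w (p + i) h := by
  induction i with
  | zero => rfl
  | succ i ih =>
    have h1 := ih fun j h1 h2 => hb j h1 (by omega)
    have h2 := levelLo_mono (w := w) (h := h) hw (Nat.le_succ (p + i))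
    have h3 := hb (p + i + 1) (by omega) (by omega)
    simp only [Nat.succ_eq_add_one] at h2
    rw [← add_assoc, cellStart, if_pos h3]
    omega

theorem cellStart_add_of_false (hwN : w N = 0) {p h i : ℕ} (hh : h < N)
    (hb : ∀ j, p < j → j ≤ p + i → b j = false) :
    cellStart w b (p + i) h + levelHi w (p + i) h = cellStart w b p h + levelHi w p h := by
  induction i with
  | zero => rfl
  | succ i ih =>
    have h1 := ih fun j h1 h2 => hb j h1 (by omega)
    have h2 := levelHi_anti (w := w) (N := N) hwN hh (Nat.le_succ (p + i))
    have h3 := hb (p + i + 1) (by omega) (by omega)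
    simp only [Nat.succ_eq_add_one] at h2
    rw [← add_assoc, cellStart, if_neg (by simp [h3])]
    omega

/-- `[l, u)` is a cell of level `p`. -/
structure IsCell (w : ℕ → ℕ) (N p l u : ℕ) : Prop where
  lt : l < u
  le : u ≤ N
  level_left : w l ≤ p
  level_right : w u ≤ p
  level_inner : ∀ t, l < t → t < u → p < w t

theorem IsCell.level_eq {p l u h : ℕ} (hc : IsCell w N p l u) (h1 : l ≤ h) (h2 : h < u) :
    levelLo w p h = l ∧ (w N = 0 → levelHi w p h = u) ∧
      (w 0 = 0 → w N = 0 → cellStart w b p h = cellStart w b p l) := by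
  have H : ∀ t, l < t → t ≤ h → p < w t := fun t ht ht' => hc.level_inner t ht (by omega)
  refine ⟨le_antisymm ?_ (le_levelLo h1 hc.level_left), fun hwN => le_antisymm
    (levelHi_le h2 hc.level_right) ?_, fun hw hwN => (cellStart_eq_of_forall hw hwN
      (h2.trans_le hc.le) h1 H).symm⟩
  · by_contra hcon
    have h3 := H _ (not_le.1 hcon) levelLo_le
    have h4 : w (levelLo w p h) ≤ p :=
      Nat.findGreatest_spec (P := fun t => w t ≤ p) h1 hc.level_left
    omega
  · have h3 := levelHi_spec (w := w) (N := N) (p := p) hwN (h2.trans_le hc.le)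
    by_contra hcon
    have := hc.level_inner _ (h1.trans_lt h3.1) (not_le.1 hcon)
    omega

/-- Increasing bits merely translate the subcells of level `p + m`. As `l + q` is a boundary between
them, the first `q` places receive exactly `[l, l + q)`. -/
theorem IsCell.cellStart_lt_iff_of_true {p l u h m q D : ℕ} (hc : IsCell w N p l u) (hw : w 0 = 0)
    (hwN : w N = 0) (h1 : l ≤ h) (h2 : h < u) (hD : p + m ≤ D)
    (hb : ∀ j, p < j → j ≤ p + m → b j = true) (hq : w (l + q) ≤ p + m) :
    cellStart w b D h < cellStart w b p l + q ↔ h < l + q := by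
  have e1 := hc.level_eq (b := b) h1 h2
  have e2 := cellStart_add_of_true (h := h) hw hb
  have hh : h < N := h2.trans_le hc.le
  have n := cellStart_nested (b := b) hw hwN hh hD
  have e3 := e1.2.2 hw hwN
  have l1 := levelLo_le (w := w) (p := D) (h := h)
  have l2 := levelHi_spec (w := w) (p := D) hwN hh
  have l3 := levelLo_le (w := w) (p := p + m) (h := h)
  have l4 := levelHi_spec (w := w) (p := p + m) hwN hh
  constructor
  · intro h3
    by_contra hcon
    have := le_levelLo (not_lt.1 hcon) hq
    omega
  · intro h3
    have := levelHi_le h3 hq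
    omega

/-- Decreasing bits reverse the order of the subcells, so the first `q` places receive the last `q`
heights; here `u - q` must be a boundary. -/
theorem IsCell.cellStart_lt_iff_of_false {p l u h m q D : ℕ} (hc : IsCell w N p l u) (hw : w 0 = 0)
    (hwN : w N = 0) (h1 : l ≤ h) (h2 : h < u) (hD : p + m ≤ D)
    (hb : ∀ j, p < j → j ≤ p + m → b j = false) (hq : w (u - q) ≤ p + m) :
    cellStart w b D h < cellStart w b p l + q ↔ u - q ≤ h := by
  have hh : h < N := h2.trans_le hc.le
  have e1 := hc.level_eq (b := b) h1 h2
  have e2 := cellStart_add_of_false (h := h) hwN hh hb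
  have n := cellStart_nested (b := b) hw hwN hh hD
  have e3 := e1.2.2 hw hwN
  have e4 := e1.2.1 hwN
  have l1 := levelLo_le (w := w) (p := D) (h := h)
  have l2 := levelHi_spec (w := w) (p := D) hwN hh
  have l3 := levelLo_le (w := w) (p := p + m) (h := h)
  have l4 := levelHi_spec (w := w) (p := p + m) hwN hh
  constructor
  · intro h3
    by_contra hcon
    have := levelHi_le (not_le.1 hcon) hq
    omega
  · intro h3
    have := le_levelLo h3 hq
    omega

open Finset in
/-- The number of `h < r` which are moved to the left of `θ`. -/
noncomputable def cellCount (w : ℕ → ℕ) (b : ℕ → Bool) (D θ r : ℕ) : ℕ :=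
  #{h ∈ range r | cellStart w b D h < θ}

open Finset in
theorem cellCount_congr (hw : w 0 = 0) (hwN : w N = 0) {D : ℕ} (hD : ∀ t ≤ N, w t ≤ D)
    {t : ℕ} (ht : t ≤ N) (hb : ∀ i, 1 ≤ i → i ≤ w t → b i = b' i) (θ : ℕ) :
    cellCount w b D θ t = cellCount w b' D θ t := by
  have key : ∀ b, cellCount w b D θ t =
      #{x ∈ (range t).image (cellStart w b D) | x < θ} := by
    intro b
    rw [cellCount, filter_image, card_image_of_injOn]
    refine (cellStart_injOn hw hwN hD).mono fun h hh => ?_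
    simp only [coe_filter, mem_range, Set.mem_ofPred_eq, coe_range, Set.mem_Iio] at hh ⊢
    exact hh.1.trans_le ht
  rw [key, key, image_cellStart_congr hw hwN hD ht hb]

open Finset in
theorem cellCount_eq_add {D θ l r : ℕ} (hlr : l ≤ r) :
    cellCount w b D θ r = cellCount w b D θ l +
      #{h ∈ Ico l r | cellStart w b D h < θ} := by
  rw [cellCount, cellCount, ← card_union_of_disjoint, ← filter_union]
  · rw [range_eq_Ico, range_eq_Ico, Ico_union_Ico_eq_Ico (Nat.zero_le l) hlr]
  · refine disjoint_filter_filter ?_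
    rw [disjoint_left]
    intro x hx hx'
    rw [mem_range] at hx
    rw [mem_Ico] at hx'
    omega

-- Heights below `l` contribute equally, since `w l ≤ p` and the orientations agree there. Inside
-- the cell one counts `[l, l + q) ∩ [l, r)` against `[u - q, s)`. Subtractions are truncated, and
-- the additive form avoids signed counts.
open Finset in
theorem IsCell.cellCount_sub {p l u m q D r s : ℕ} (hc : IsCell w N p l u) (hw : w 0 = 0)
    (hwN : w N = 0) (hwD : ∀ t ≤ N, w t ≤ D) (hD : p + m ≤ D)
    (hagree : ∀ i, 1 ≤ i → i ≤ p → b i = b' i)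
    (hb : ∀ j, p < j → j ≤ p + m → b j = true) (hb' : ∀ j, p < j → j ≤ p + m → b' j = false)
    (hq : w (l + q) ≤ p + m) (hq' : w (u - q) ≤ p + m) (hqu : q ≤ u - l)
    (hr : l ≤ r) (hru : r ≤ u) (hs : l ≤ s) (hsu : s ≤ u) :
    cellCount w b D (cellStart w b p l + q) r + (s - (u - q)) =
      cellCount w b' D (cellStart w b p l + q) s + min (r - l) q := by
  have hlt := hc.lt
  rw [cellCount_eq_add hr, cellCount_eq_add hs, cellCount_congr (b := b) (b' := b') hw hwN hwD
    (hlt.le.trans hc.le) fun i h1 h2 => hagree i h1 (h2.trans hc.level_left)]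
  have c1 : #{h ∈ Ico l r | cellStart w b D h < cellStart w b p l + q} = min (r - l) q := by
    rw [show ({h ∈ Ico l r | cellStart w b D h < cellStart w b p l + q} : Finset ℕ) =
      Ico l (min r (l + q)) from ?_]
    · rw [Nat.card_Ico]; omega
    · ext h
      simp only [mem_filter, mem_Ico, lt_min_iff]
      constructor
      · rintro ⟨⟨h1, h2⟩, h3⟩
        exact ⟨h1, h2, (hc.cellStart_lt_iff_of_true hw hwN h1 (by omega) hD hb hq).1 h3⟩
      · rintro ⟨h1, h2, h3⟩
        exact ⟨⟨h1, h2⟩, (hc.cellStart_lt_iff_of_true hw hwN h1 (by omega) hD hb hq).2 h3⟩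
  have c2 : #{h ∈ Ico l s | cellStart w b' D h < cellStart w b p l + q} = s - (u - q) := by
    rw [show ({h ∈ Ico l s | cellStart w b' D h < cellStart w b p l + q} : Finset ℕ) =
      Ico (u - q) s from ?_]
    · rw [Nat.card_Ico]
    · rw [cellStart_congr hagree]
      ext h
      simp only [mem_filter, mem_Ico]
      constructor
      · rintro ⟨⟨h1, h2⟩, h3⟩
        exact ⟨(hc.cellStart_lt_iff_of_false hw hwN h1 (by omega) hD hb' hq').1 h3, h2⟩
      · rintro ⟨h1, h2⟩
        have h0 : l ≤ h := by omega
        exact ⟨⟨h0, h2⟩, (hc.cellStart_lt_iff_of_false hw hwN h0 (by omega) hD hb' hq').2 h1⟩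
  omega

end Order

/-! ### Sums of rearranged initial segments -/

open Finset in
/-- The alternating sum of the indicators of the rearrangements of `[0, r)`, in `2 n` consecutive
blocks of length `N`. -/
noncomputable def blockVec (w : ℕ → ℕ) (N D n : ℕ) (β : ℕ → ℕ → Bool) (r : ℕ) : ℕ →₀ ℝ :=
  ∑ j ∈ range n, ∑ h ∈ range r,
    (Finsupp.single (2 * j * N + cellStart w (β j) D h) 1 -
      Finsupp.single ((2 * j + 1) * N + cellStart w (β j) D h) 1)

section BlockVec

variable {w : ℕ → ℕ} {N D n : ℕ} {β β' : ℕ → ℕ → Bool}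

open Finset in
theorem blockVec_congr (hw : w 0 = 0) (hwN : w N = 0) (hD : ∀ t ≤ N, w t ≤ D)
    {r : ℕ} (hr : r ≤ N) (hb : ∀ j < n, ∀ i, 1 ≤ i → i ≤ w r → β j i = β' j i) :
    blockVec w N D n β r = blockVec w N D n β' r := by
  refine sum_congr rfl fun j hj => ?_
  have key : ∀ b : ℕ → Bool, ∑ h ∈ range r,
      (Finsupp.single (2 * j * N + cellStart w b D h) (1 : ℝ) -
        Finsupp.single ((2 * j + 1) * N + cellStart w b D h) 1) =
      ∑ x ∈ (range r).image (cellStart w b D), (Finsupp.single (2 * j * N + x) (1 : ℝ) -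
        Finsupp.single ((2 * j + 1) * N + x) 1) := by
    intro b
    rw [sum_image]
    refine (cellStart_injOn hw hwN hD).mono fun h hh => ?_
    simp only [coe_range, Set.mem_Iio] at hh ⊢
    exact hh.trans_le hr
  rw [key, key, image_cellStart_congr hw hwN hD hr (hb j (mem_range.1 hj))]

theorem mapDomain_blockVec (φ : ℕ → ℕ) (r : ℕ) :
    (blockVec w N D n β r).mapDomain φ = ∑ j ∈ Finset.range n, ∑ h ∈ Finset.range r,
      (Finsupp.single (φ (2 * j * N + cellStart w (β j) D h)) (1 : ℝ) -
        Finsupp.single (φ ((2 * j + 1) * N + cellStart w (β j) D h)) 1) := by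
  simp only [blockVec, Finsupp.mapDomain_finsetSum, mapDomain_sub_real, Finsupp.mapDomain_single]

variable {X : Type*} [NormedAddCommGroup X] [NormedSpace ℝ X] {e : ℕ → X}

-- The increment is a single basis vector in each block, with alternating signs: a spread copy of
-- `altVec n`.
open Finset in
theorem IsESA.norm_blockVec_succ (he : IsESA e) (hw : w 0 = 0) (hwN : w N = 0) {r : ℕ}
    (hr : r < N) :
    ‖Finsupp.linearCombination ℝ e (blockVec w N D n β (r + 1) - blockVec w N D n β r)‖ =
      altNorm e n := by
  have h := he.norm_mapDomain_of_strictMono (altVec n)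
    (fun i => i * N + cellStart w (β (i / 2)) D r) (fun i j hij => by
      have h1 := cellStart_lt (b := β (i / 2)) hw hwN hr D
      have h2 := Nat.mul_le_mul_right N (show i + 1 ≤ j from hij)
      rw [add_mul, one_mul] at h2
      change i * N + cellStart w (β (i / 2)) D r < j * N + cellStart w (β (j / 2)) D r
      omega)
  rw [mapDomain_altVec] at h
  rw [altNorm, ← h, blockVec, blockVec, ← sum_sub_distrib]
  congr 2
  refine sum_congr rfl fun j _ => ?_
  rw [sum_range_succ, add_sub_cancel_left, show 2 * j / 2 = j by omega,
    show (2 * j + 1) / 2 = j by omega]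

-- Merge every block of length `N` to one point: only the number of occupied places survives.
open Finset in
theorem IsESA.mul_altNorm_le_norm_blockVec_sub_of_length (he : IsESA e) (hw : w 0 = 0)
    (hwN : w N = 0) {r s : ℕ} (hr : r ≤ N) (hs : s ≤ N) :
    |(r : ℝ) - s| * altNorm e n ≤
      ‖Finsupp.linearCombination ℝ e (blockVec w N D n β r - blockVec w N D n β' s)‖ := by
  have h := he.norm_mapDomain_le (blockVec w N D n β r - blockVec w N D n β' s) (fun x => x / N)
    (fun x y h => Nat.div_le_div_right h)
  have key : ∀ (β : ℕ → ℕ → Bool) (r : ℕ), r ≤ N →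
      (blockVec w N D n β r).mapDomain (fun x => x / N) = (r : ℝ) • altVec n := by
    intro β r hr
    rw [mapDomain_blockVec, altVec, smul_sum]
    refine sum_congr rfl fun j _ => ?_
    have : ∀ h ∈ range r, (Finsupp.single ((2 * j * N + cellStart w (β j) D h) / N) (1 : ℝ) -
        Finsupp.single (((2 * j + 1) * N + cellStart w (β j) D h) / N) 1) =
        Finsupp.single (2 * j) 1 - Finsupp.single (2 * j + 1) 1 := by
      intro h hh
      have hlt := cellStart_lt (b := β j) hw hwN ((mem_range.1 hh).trans_le hr) D
      have hN : 0 < N := by omega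
      rw [mul_comm _ N, mul_comm _ N, Nat.mul_add_div hN, Nat.mul_add_div hN,
        Nat.div_eq_of_lt hlt, add_zero, add_zero]
    rw [sum_congr rfl this, sum_const, card_range, Nat.cast_smul_eq_nsmul]
  rw [mapDomain_sub_real, key β r hr, key β' s hs, ← sub_smul, map_smul, norm_smul] at h
  exact h

open Finset in
theorem IsESA.mul_altNorm_le_norm_blockVec_sub (he : IsESA e) (hw : w 0 = 0)
    (hwN : w N = 0) {r s : ℕ} (hr : r ≤ N) (hs : s ≤ N) (B : Finset ℕ) (θ : ℕ → ℕ) (α : ℝ)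
    (hα : ∀ j ∈ B, (cellCount w (β j) D (θ j) r : ℝ) - cellCount w (β' j) D (θ j) s = α) :
    |α| * altNorm e (Nat.count (· ∈ B) n) ≤
      ‖Finsupp.linearCombination ℝ e (blockVec w N D n β r - blockVec w N D n β' s)‖ := by
  set c : ℕ → ℕ := fun j => Nat.count (· ∈ B) j with hc
  -- For `j ∈ B` the places left of `θ j` in the positive block go to `2 * c j`, its other places
  -- and the whole negative block to `2 * c j + 1`. This leaves `cellCount` times one alternating
  -- pair. For `j ∉ B` the two blocks merge and cancel.
  set φ : ℕ → ℕ := fun x => if x / N / 2 ∈ B ∧ ¬ (x / N % 2 = 0 ∧ x % N < θ (x / N / 2)) then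
    2 * c (x / N / 2) + 1 else 2 * c (x / N / 2) with hφ
  have hmono : Monotone φ := by
    intro x y hxy
    have h1 : x / N ≤ y / N := Nat.div_le_div_right hxy
    have h2 : x / N / 2 ≤ y / N / 2 := Nat.div_le_div_right h1
    simp only [hφ]
    rcases h2.lt_or_eq with h3 | h3
    · have h4 : c (x / N / 2 + 1) ≤ c (y / N / 2) := Nat.count_monotone _ h3
      by_cases hx : x / N / 2 ∈ B
      · have h5 : c (x / N / 2 + 1) = c (x / N / 2) + 1 := by simp [hc, Nat.count_succ, hx]
        split_ifs <;> omega
      · have h5 : c (x / N / 2 + 1) = c (x / N / 2) := by simp [hc, Nat.count_succ, hx]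
        simp only [hx, false_and, if_false]
        split_ifs <;> omega
    · rw [← h3]
      by_cases hx : x / N / 2 ∈ B
      · simp only [hx, true_and]
        split_ifs with h4 h5 h5
        · exact le_rfl
        · omega
        · exfalso
          refine h4 ⟨by omega, ?_⟩
          have h6 : x / N = y / N := by omega
          have h7 := Nat.div_add_mod x N
          have h8 := Nat.div_add_mod y N
          rw [h6] at h7
          omega
        · exact le_rfl
      · simp [hx]
  have h := he.norm_mapDomain_le (blockVec w N D n β r - blockVec w N D n β' s) φ hmono
  have key : ∀ (β : ℕ → ℕ → Bool) (r : ℕ), r ≤ N → (blockVec w N D n β r).mapDomain φ =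
      ∑ j ∈ (range n).filter (· ∈ B), (cellCount w (β j) D (θ j) r : ℝ) •
        (Finsupp.single (2 * c j) (1 : ℝ) - Finsupp.single (2 * c j + 1) 1) := by
    intro β r hr
    rw [mapDomain_blockVec, sum_filter]
    refine sum_congr rfl fun j _ => ?_
    have hval : ∀ h ∈ range r, ∀ i, (i * N + cellStart w (β j) D h) / N = i ∧
        (i * N + cellStart w (β j) D h) % N = cellStart w (β j) D h := by
      intro h hh i
      have hlt := cellStart_lt (b := β j) hw hwN ((mem_range.1 hh).trans_le hr) D
      have hN : 0 < N := by omega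
      rw [mul_comm _ N, Nat.mul_add_div hN, Nat.mul_add_mod, Nat.div_eq_of_lt hlt,
        Nat.mod_eq_of_lt hlt, add_zero]
      exact ⟨rfl, rfl⟩
    have d1 : 2 * j / 2 = j := by omega
    have d2 : (2 * j + 1) / 2 = j := by omega
    have d3 : 2 * j % 2 = 0 := by omega
    have d4 : (2 * j + 1) % 2 = 1 := by omega
    split_ifs with hj
    · rw [cellCount, card_filter, Nat.cast_sum, sum_smul]
      refine sum_congr rfl fun h hh => ?_
      simp only [hφ, (hval h hh _).1, (hval h hh _).2, d1, d2, d3, d4, hj, true_and]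
      by_cases hlt : cellStart w (β j) D h < θ j <;> simp [hlt]
    · refine sum_eq_zero fun h hh => ?_
      simp [hφ, (hval h hh _).1, d1, d2, hj]
  have hfin : ∑ j ∈ (range n).filter (· ∈ B),
      (Finsupp.single (2 * c j) (1 : ℝ) - Finsupp.single (2 * c j + 1) 1) =
      altVec (Nat.count (· ∈ B) n) :=
    sum_filter_count B (fun i => Finsupp.single (2 * i) (1 : ℝ) - Finsupp.single (2 * i + 1) 1) n
  rw [mapDomain_sub_real, key β r hr, key β' s hs, ← sum_sub_distrib] at h
  rw [sum_congr rfl (g := fun j => α • (Finsupp.single (2 * c j) (1 : ℝ) -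
    Finsupp.single (2 * c j + 1) 1)) (fun j hj => by
      rw [← sub_smul, hα j (mem_filter.1 hj).2]), ← smul_sum, hfin, map_smul, norm_smul] at h
  exact h

end BlockVec

/-! ### Independent orientations -/

open Finset in
theorem two_pow_card_le_mul_card_filter {ν : Type*} [Fintype ν] [DecidableEq ν] (P Q : Finset ν)
    (h : Disjoint P Q) :
    Fintype.card (ν → Bool) ≤ 2 ^ (#P + #Q) *
      #{ω : ν → Bool | (∀ x ∈ P, ω x = true) ∧ ∀ x ∈ Q, ω x = false} := by
  set t : ν → Finset Bool := fun x => if x ∈ P then {true} else if x ∈ Q then {false} else univ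
    with ht
  have hsub : Fintype.piFinset t ⊆
      ({ω : ν → Bool | (∀ x ∈ P, ω x = true) ∧ ∀ x ∈ Q, ω x = false} : Finset (ν → Bool)) := by
    intro ω hω
    rw [Fintype.mem_piFinset] at hω
    simp only [mem_filter, mem_univ, true_and]
    refine ⟨fun x hx => ?_, fun x hx => ?_⟩
    · simpa [ht, hx] using hω x
    · have hx' : x ∉ P := fun h' => disjoint_left.1 h h' hx
      simpa [ht, hx, hx'] using hω x
  have hcard : Fintype.card (ν → Bool) ≤ 2 ^ (#P + #Q) * #(Fintype.piFinset t) := by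
    have e1 : (2 : ℕ) ^ #P = ∏ x : ν, if x ∈ P then 2 else 1 := by simp [prod_ite_mem]
    have e2 : (2 : ℕ) ^ #Q = ∏ x : ν, if x ∈ Q then 2 else 1 := by simp [prod_ite_mem]
    rw [Fintype.card_piFinset, pow_add, e1, e2, ← prod_mul_distrib, ← prod_mul_distrib,
      Fintype.card_fun, Fintype.card_bool, ← card_univ, ← prod_const]
    refine prod_le_prod' fun x _ => ?_
    by_cases hP : x ∈ P <;> by_cases hQ : x ∈ Q <;> simp [ht, hP, hQ]
  exact hcard.trans (Nat.mul_le_mul_left _ (card_le_card hsub))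

/-- The `p`-th prefix of a branch, for `p ≤ D`. -/
def branchNode {κ : Type*} [Inhabited κ] (D : ℕ) (ξ : ℕ → κ) (p : ℕ) :
    Fin (D + 1) × (Fin D → κ) :=
  (⟨min p D, by omega⟩, fun i => if (i : ℕ) < p then ξ i else default)

theorem branchNode_congr {κ : Type*} [Inhabited κ] {D : ℕ} {ξ η : ℕ → κ} {p : ℕ}
    (h : ∀ i < p, ξ i = η i) : branchNode D ξ p = branchNode D η p := by
  unfold branchNode
  refine Prod.ext rfl (funext fun i => ?_)
  simp only
  split_ifs with hi
  · exact h _ hi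
  · rfl

/-- The orientations along the branch `ξ` in the `j`-th of all assignments of orientations. -/
noncomputable def branchBits {κ : Type*} [Inhabited κ] [Fintype κ] [DecidableEq κ] (D : ℕ) (ξ : ℕ → κ)
    (j p : ℕ) : Bool :=
  if h : j < Fintype.card (Fin (D + 1) × (Fin D → κ) → Bool) then
    (Fintype.equivFin (Fin (D + 1) × (Fin D → κ) → Bool)).symm ⟨j, h⟩ (branchNode D ξ p)
  else false

theorem branchBits_congr {κ : Type*} [Inhabited κ] [Fintype κ] [DecidableEq κ] {D : ℕ} {ξ η : ℕ → κ} {p : ℕ}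
    (h : ∀ i < p, ξ i = η i) (j : ℕ) : branchBits D ξ j p = branchBits D η j p := by
  rw [branchBits, branchBits, branchNode_congr h]

/-- The number of all assignments of orientations. -/
def orientationCard (κ : Type*) [Fintype κ] [DecidableEq κ] (D : ℕ) : ℕ :=
  Fintype.card (Fin (D + 1) × (Fin D → κ) → Bool)

open Finset in
/-- The assignments of orientations which are increasing on `m` prefixes of `ξ` and decreasing on
`m` prefixes of `η`. -/
noncomputable def separatingSet {κ : Type*} [Inhabited κ] [Fintype κ] [DecidableEq κ] (D : ℕ) (ξ η : ℕ → κ)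
    (p m : ℕ) : Finset ℕ := by
  classical
  exact {j ∈ range (orientationCard κ D) | ∀ i, p < i → i ≤ p + m →
    branchBits D ξ j i = true ∧ branchBits D η j i = false}

-- Prefixes longer than `p` contain the entry at which the branches differ, so the two groups of at
-- most `m` nodes are disjoint. Fixing at most `2 * m` independent bits costs a factor at most `4 ^
-- m`.
open Finset in
theorem orientationCard_le {κ : Type*} [Inhabited κ] [Fintype κ] [DecidableEq κ] {D : ℕ} {ξ η : ℕ → κ}
    {p m : ℕ} (hp : ξ p ≠ η p) (hD : p + m ≤ D) :
    orientationCard κ D ≤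
      4 ^ m * Nat.count (· ∈ separatingSet D ξ η p m) (orientationCard κ D) := by
  classical
  set n := orientationCard κ D with hn
  set E := Fintype.equivFin (Fin (D + 1) × (Fin D → κ) → Bool) with hE
  set P := (Ioc p (p + m)).image (branchNode D ξ) with hP
  set Q := (Ioc p (p + m)).image (branchNode D η) with hQ
  have hdisj : Disjoint P Q := by
    rw [disjoint_left]
    intro x hx hx'
    obtain ⟨i, hi, rfl⟩ := mem_image.1 hx
    obtain ⟨i', hi', heq⟩ := mem_image.1 hx'
    rw [mem_Ioc] at hi hi'
    have h1 := congrArg (fun z => (z.1 : ℕ)) heq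
    simp only [branchNode] at h1
    have h2 : i' = i := by omega
    subst h2
    have h3 := congrFun (congrArg Prod.snd heq) ⟨p, by omega⟩
    simp only [branchNode, if_pos hi.1] at h3
    exact hp h3.symm
  have h1 := two_pow_card_le_mul_card_filter P Q hdisj
  have hPm : #P ≤ m := card_image_le.trans (by simp)
  have hQm : #Q ≤ m := card_image_le.trans (by simp)
  have h2 : #{ω : Fin (D + 1) × (Fin D → κ) → Bool |
      (∀ x ∈ P, ω x = true) ∧ ∀ x ∈ Q, ω x = false} ≤
      Nat.count (· ∈ separatingSet D ξ η p m) n := by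
    rw [Nat.count_eq_card_filter_range]
    refine card_le_card_of_injOn (fun ω => (E ω : ℕ)) ?_
      (fun ω _ ω' _ h => E.injective (Fin.ext h))
    intro ω hω
    simp only [coe_filter, mem_univ, true_and, Set.mem_ofPred_eq] at hω
    have hlt : (E ω : ℕ) < n := (E ω).2
    have hbit : ∀ (ζ : ℕ → κ) (i : ℕ), branchBits D ζ (E ω : ℕ) i = ω (branchNode D ζ i) := by
      intro ζ i
      rw [branchBits, dif_pos (show (E ω : ℕ) < _ from (E ω).2)]
      simp [hE]
    simp only [coe_filter, mem_range, Set.mem_ofPred_eq, separatingSet, mem_filter]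
    refine ⟨hlt, hlt, fun i hi hi' => ?_⟩
    rw [hbit, hbit]
    exact ⟨hω.1 _ (mem_image_of_mem _ (mem_Ioc.2 ⟨hi, hi'⟩)),
      hω.2 _ (mem_image_of_mem _ (mem_Ioc.2 ⟨hi, hi'⟩))⟩
  refine h1.trans (Nat.mul_le_mul ?_ h2)
  calc 2 ^ (#P + #Q) ≤ 2 ^ (2 * m) := Nat.pow_le_pow_right (by norm_num) (by omega)
    _ = 4 ^ m := by rw [pow_mul]; norm_num

/-- The image of the vertex of height `r` on the branch `ξ`. -/
noncomputable def branchVec {κ : Type*} [Inhabited κ] [Fintype κ] [DecidableEq κ] (w : ℕ → ℕ) (N D : ℕ)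
    (ξ : ℕ → κ) (r : ℕ) : ℕ →₀ ℝ :=
  blockVec w N D (orientationCard κ D) (branchBits D ξ) r

/-! ### Separation of diverging branches -/

section BranchVec

variable {κ : Type*} [Inhabited κ] [Fintype κ] [DecidableEq κ] {w : ℕ → ℕ} {N D : ℕ} {ξ η : ℕ → κ}

theorem branchVec_congr (hw : w 0 = 0) (hwN : w N = 0) (hD : ∀ t ≤ N, w t ≤ D)
    {r : ℕ} (hr : r ≤ N) (h : ∀ i < w r, ξ i = η i) :
    branchVec w N D ξ r = branchVec w N D η r :=
  blockVec_congr hw hwN hD hr fun j _ _ _ hi =>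
    branchBits_congr (fun k hk => h k (hk.trans_le hi)) j

variable {X : Type*} [NormedAddCommGroup X] [NormedSpace ℝ X] {e : ℕ → X}

theorem IsESA.norm_branchVec_sub_of_cell (he : IsESA e) (hw : w 0 = 0) (hwN : w N = 0)
    (hwD : ∀ t ≤ N, w t ≤ D) {p m q l u r s : ℕ} (hc : IsCell w N p l u) (hD : p + m ≤ D)
    (hagree : ∀ i < p, ξ i = η i) (hp : ξ p ≠ η p)
    (hq : w (l + q) ≤ p + m) (hq' : w (u - q) ≤ p + m) (hqu : q ≤ u - l)
    (hr : l ≤ r) (hru : r ≤ u) (hs : l ≤ s) (hsu : s ≤ u) :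
    |((min (r - l) q : ℕ) : ℝ) - (s - (u - q) : ℕ)| * altNorm e (orientationCard κ D) ≤
      4 ^ m * ‖Finsupp.linearCombination ℝ e (branchVec w N D ξ r - branchVec w N D η s)‖ := by
  have h1 := he.mul_altNorm_le_norm_blockVec_sub (D := D) (n := orientationCard κ D)
    (β := branchBits D ξ) (β' := branchBits D η) hw hwN (hru.trans hc.le) (hsu.trans hc.le)
    (separatingSet D ξ η p m) (fun j => cellStart w (branchBits D ξ j) p l + q)
    (((min (r - l) q : ℕ) : ℝ) - (s - (u - q) : ℕ)) (fun j hj => by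
      simp only [separatingSet, Finset.mem_filter] at hj
      have := hc.cellCount_sub (b := branchBits D ξ j) (b' := branchBits D η j) hw hwN hwD hD
        (fun i _ hi => branchBits_congr (fun k hk => hagree k (hk.trans_le hi)) j)
        (fun i hi hi' => (hj.2 i hi hi').1) (fun i hi hi' => (hj.2 i hi hi').2) hq hq' hqu hr hru
        hs hsu
      have h2 : ((_ : ℕ) : ℝ) = ((_ : ℕ) : ℝ) := congrArg Nat.cast this
      push_cast [-Nat.cast_sub, -Nat.cast_min] at h2
      linarith)
  -- Monotonicity and subadditivity of `altNorm` turn the proportion `4 ^ (-m)` of assignments into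
  -- the same factor for norms.
  have h2 := (he.altNorm_mono (orientationCard_le hp hD)).trans (he.altNorm_mul_le _ _)
  push_cast at h2
  have h3 := mul_le_mul_of_nonneg_left h2
    (abs_nonneg (((min (r - l) q : ℕ) : ℝ) - (s - (u - q) : ℕ)))
  have h4 := mul_le_mul_of_nonneg_left h1 (show (0 : ℝ) ≤ 4 ^ m by positivity)
  rw [branchVec, branchVec]
  refine h3.trans (le_trans (le_of_eq ?_) h4)
  ring

/-- Every cell of the level structure has, `m` levels deeper, two symmetric inner points at a
distance from its ends which is at least the `K`-th part of its length. -/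
def HasSymmetricCuts (N : ℕ) (w : ℕ → ℕ) (m K : ℕ) : Prop :=
  ∀ p l u, IsCell w N p l u → l + 2 ≤ u →
    ∃ q, 1 ≤ q ∧ 2 * q ≤ u - l ∧ u - l ≤ K * q ∧ w (l + q) ≤ p + m ∧ w (u - q) ≤ p + m

theorem IsESA.le_norm_branchVec_sub_of_cell (he : IsESA e) (hw : w 0 = 0) (hwN : w N = 0)
    {m K : ℕ} (hcuts : HasSymmetricCuts N w m K)
    (hwD : ∀ t ≤ N, w t ≤ D) {p l u r s d : ℕ} (hc : IsCell w N p l u) (hD : p + m ≤ D)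
    (hagree : ∀ i < p, ξ i = η i) (hp : ξ p ≠ η p)
    (hr : l < r) (hru : r ≤ u) (hs : l ≤ s) (hsu : s < u) (hrs : r ≤ s)
    (hd : d ≤ (r - l) + (s - l)) (hd' : d ≤ (u - r) + (u - s)) :
    d * altNorm e (orientationCard κ D) ≤ 4 ^ m * K *
      ‖Finsupp.linearCombination ℝ e (branchVec w N D ξ r - branchVec w N D η s)‖ := by
  obtain ⟨q, hq1, hq2, hq3, hq4, hq5⟩ := hcuts p l u hc (by omega)
  have h1 := he.norm_branchVec_sub_of_cell hw hwN hwD hc hD hagree hp hq4 hq5 (by omega) hr.le hru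
    hs hsu.le
  have h2 := he.norm_branchVec_sub_of_cell hw hwN hwD hc hD (fun i hi => (hagree i hi).symm)
    hp.symm hq4 hq5 (by omega) hs hsu.le hr.le hru
  have hrev : ‖Finsupp.linearCombination ℝ e (branchVec w N D η s - branchVec w N D ξ r)‖ =
      ‖Finsupp.linearCombination ℝ e (branchVec w N D ξ r - branchVec w N D η s)‖ := by
    rw [map_sub, map_sub, norm_sub_rev]
  rw [hrev] at h2
  set ν := ‖Finsupp.linearCombination ℝ e (branchVec w N D ξ r - branchVec w N D η s)‖
  set lam := altNorm e (orientationCard κ D)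
  have hlam : 0 ≤ lam := norm_nonneg _
  have hK2 : 2 ≤ K := by
    by_contra hcon
    have : K * q ≤ 1 * q := Nat.mul_le_mul_right q (by omega)
    omega
  have key : ∀ x y : ℕ, y ≤ x → (q ≤ x - y ∨ d ≤ 2 * (x - y)) →
      |(x : ℝ) - y| * lam ≤ 4 ^ m * ν → d * lam ≤ 4 ^ m * K * ν := by
    intro x y hyx hxy h
    have hle : d ≤ K * (x - y) := by
      rcases hxy with h | h
      · have := Nat.mul_le_mul_left K h
        omega
      · exact h.trans (Nat.mul_le_mul_right _ hK2)
    rw [← Nat.cast_sub hyx, Nat.abs_cast] at h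
    have h3 : (d : ℝ) ≤ K * (x - y : ℕ) := by exact_mod_cast hle
    calc (d : ℝ) * lam ≤ K * (x - y : ℕ) * lam := mul_le_mul_of_nonneg_right h3 hlam
      _ = K * ((x - y : ℕ) * lam) := by ring
      _ ≤ K * (4 ^ m * ν) := mul_le_mul_of_nonneg_left h (Nat.cast_nonneg K)
      _ = 4 ^ m * K * ν := by ring
  -- One of the two choices of roles for the branches gives a count difference of at least `q` or `d
  -- / 2`. Adding `hd` and `hd'` gives `d ≤ u - l ≤ K * q`, and `2 ≤ K`, so either is at least `d /
  -- K`.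
  have hcases : (s - (u - q) ≤ min (r - l) q ∧ (q ≤ min (r - l) q - (s - (u - q)) ∨
      d ≤ 2 * (min (r - l) q - (s - (u - q))))) ∨
      (r - (u - q) ≤ min (s - l) q ∧ (q ≤ min (s - l) q - (r - (u - q)) ∨
      d ≤ 2 * (min (s - l) q - (r - (u - q))))) := by
    omega
  rcases hcases with ⟨h3, h4⟩ | ⟨h3, h4⟩
  · exact key _ _ h3 h4 h1
  · exact key _ _ h3 h4 h2

end BranchVec

/-! ### Graphs coded by heights and finite sequences -/

/-- The initial segment of length `k` of a branch. -/
def branchList {κ : Type*} (ξ : ℕ → κ) (k : ℕ) : List κ := (List.range k).map ξ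

section BranchList

variable {κ : Type*} {ξ η : ℕ → κ}

@[simp] theorem length_branchList (k : ℕ) : (branchList ξ k).length = k := by simp [branchList]

theorem branchList_prefix {k l : ℕ} (h : k ≤ l) : branchList ξ k <+: branchList ξ l := by
  refine List.IsPrefix.map ξ ?_
  rw [← min_eq_left h, ← List.take_range]
  exact List.take_prefix _ _

theorem branchList_congr {k : ℕ} (h : ∀ i < k, ξ i = η i) : branchList ξ k = branchList η k :=
  List.map_congr_left fun i hi => h i (List.mem_range.1 hi)

/-- A branch extending a finite sequence. -/
def branchOf [Inhabited κ] (A : List κ) (i : ℕ) : κ := A.getD i default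

theorem branchList_branchOf_of_prefix [Inhabited κ] {A B : List κ} (h : A <+: B) :
    branchList (branchOf B) A.length = A := by
  refine List.ext_getElem (by simp) fun i h1 h2 => ?_
  obtain ⟨C, rfl⟩ := h
  simp [branchList, branchOf, List.getD_eq_getElem?_getD, List.getElem?_append_left h2,
    List.getElem?_eq_getElem h2]

theorem branchOf_eq_of_prefix [Inhabited κ] {A B : List κ} (h : A <+: B) {i : ℕ}
    (hi : i < A.length) : branchOf A i = branchOf B i := by
  obtain ⟨C, rfl⟩ := h
  simp [branchOf, List.getD_eq_getElem?_getD, List.getElem?_append_left hi]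

end BranchList

/-- `c` identifies the vertices of `G` with the pairs `(r, A)`, where `r ≤ N` and `A` is a sequence
in `κ` of length `w r`, adjacent vertices being those of consecutive heights whose sequences are
comparable. -/
structure TopBottomGraph.IsCoding (G : TopBottomGraph) {κ : Type} (N : ℕ) (w : ℕ → ℕ)
    (c : G.V → ℕ × List κ) : Prop where
  inj : Function.Injective c
  height_le : ∀ v, (c v).1 ≤ N
  length : ∀ v, (c v).2.length = w (c v).1
  surj : ∀ r A, r ≤ N → A.length = w r → ∃ v, c v = (r, A)
  adj : ∀ u v, G.graph.Adj u v ↔ ((c u).1 + 1 = (c v).1 ∨ (c v).1 + 1 = (c u).1) ∧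
    ((c u).2 <+: (c v).2 ∨ (c v).2 <+: (c u).2)
  bottom : c G.bottom = (0, [])
  top : c G.top = (N, [])

namespace TopBottomGraph.IsCoding

variable {G : TopBottomGraph} {κ : Type} {N : ℕ} {w : ℕ → ℕ} {c : G.V → ℕ × List κ}

theorem level_zero (hc : G.IsCoding N w c) : w 0 = 0 := by
  have := hc.length G.bottom
  rw [hc.bottom] at this
  exact this.symm

theorem level_last (hc : G.IsCoding N w c) : w N = 0 := by
  have := hc.length G.top
  rw [hc.top] at this
  exact this.symm

theorem pos (hc : G.IsCoding N w c) : 0 < N := by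
  rcases Nat.eq_zero_or_pos N with rfl | h
  · exact absurd (hc.inj (hc.bottom.trans hc.top.symm)) G.bottom_ne_top
  · exact h

/-- Points of the same branch are joined by a monotone path. -/
theorem exists_walk (hc : G.IsCoding N w c) (ξ : ℕ → κ) (r k : ℕ) (u v : G.V)
    (hu : c u = (r, branchList ξ (w r))) (hv : c v = (r + k, branchList ξ (w (r + k)))) :
    ∃ p : G.graph.Walk u v, p.length = k := by
  induction k generalizing v with
  | zero =>
    obtain rfl := hc.inj (hu.trans hv.symm)
    exact ⟨.nil, rfl⟩
  | succ k ih =>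
    have hle := hc.height_le v
    rw [hv] at hle
    obtain ⟨x, hx⟩ := hc.surj (r + k) (branchList ξ (w (r + k))) (by simp only at hle; omega)
      (by simp)
    obtain ⟨p, hp⟩ := ih x hx
    have hadj : G.graph.Adj x v := by
      rw [hc.adj, hx, hv]
      refine ⟨Or.inl rfl, ?_⟩
      rcases le_total (w (r + k)) (w (r + (k + 1))) with h | h
      · exact Or.inl (branchList_prefix h)
      · exact Or.inr (branchList_prefix h)
    exact ⟨p.concat hadj, by rw [SimpleGraph.Walk.length_concat, hp]⟩

theorem dist_le_of_branch (hc : G.IsCoding N w c) {ξ : ℕ → κ} {r s : ℕ} {u v : G.V}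
    (hu : c u = (r, branchList ξ (w r))) (hv : c v = (s, branchList ξ (w s))) (hrs : r ≤ s) :
    G.graph.dist u v ≤ s - r := by
  obtain ⟨k, rfl⟩ := Nat.exists_eq_add_of_le hrs
  obtain ⟨p, hp⟩ := hc.exists_walk ξ r k u v hu hv
  have := SimpleGraph.dist_le p
  omega

theorem height_le_add_length (hc : G.IsCoding N w c) {u v : G.V} (p : G.graph.Walk u v) :
    (c v).1 ≤ (c u).1 + p.length := by
  induction p with
  | nil => simp
  | cons h p ih =>
    have := ((hc.adj _ _).1 h).1
    rw [SimpleGraph.Walk.length_cons]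
    omega

variable [Inhabited κ]

theorem eq_branch (hc : G.IsCoding N w c) (v : G.V) :
    c v = ((c v).1, branchList (branchOf (c v).2) (w (c v).1)) := by
  refine Prod.ext rfl ?_
  simp only
  rw [← hc.length]
  exact (branchList_branchOf_of_prefix (List.prefix_refl _)).symm

theorem connected (hc : G.IsCoding N w c) : G.graph.Connected := by
  have key : ∀ v, G.graph.Reachable G.bottom v := by
    intro v
    obtain ⟨p, _⟩ := hc.exists_walk (branchOf (c v).2) 0 (c v).1 G.bottom v
      (by rw [hc.bottom, hc.level_zero]; rfl) (by rw [zero_add]; exact hc.eq_branch v)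
    exact ⟨p⟩
  exact { preconnected := fun u v => (key u).symm.trans (key v), nonempty := ⟨G.bottom⟩ }

theorem height_eq (hc : G.IsCoding N w c) (v : G.V) : G.height v = (c v).1 := by
  refine le_antisymm ?_ ?_
  · exact (hc.dist_le_of_branch (ξ := branchOf (c v).2) (r := 0)
      (by rw [hc.bottom, hc.level_zero]; rfl) (hc.eq_branch v) (Nat.zero_le _)).trans
      (Nat.sub_le _ _)
  · obtain ⟨p, hp⟩ := (hc.connected.preconnected G.bottom v).exists_walk_length_eq_dist
    have := hc.height_le_add_length p
    rw [hc.bottom, hp] at this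
    simpa [height] using this

/-- The branches share the vertex at height `t`, so one may pass through it. -/
theorem dist_le_of_common (hc : G.IsCoding N w c) {ξ η : ℕ → κ} {r s t : ℕ} {u v : G.V}
    (hu : c u = (r, branchList ξ (w r))) (hv : c v = (s, branchList η (w s))) (ht : t ≤ N)
    (h : ∀ i < w t, ξ i = η i) :
    G.graph.dist u v ≤ (r - t) + (t - r) + ((s - t) + (t - s)) := by
  obtain ⟨x, hx⟩ := hc.surj t (branchList ξ (w t)) ht (by simp)
  have hx' : c x = (t, branchList η (w t)) := by rw [hx, branchList_congr h]
  refine (hc.connected.dist_triangle (v := x)).trans (Nat.add_le_add ?_ ?_)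
  · rcases le_total r t with h | h
    · have := hc.dist_le_of_branch hu hx h
      omega
    · have := hc.dist_le_of_branch hx hu h
      rw [SimpleGraph.dist_comm]
      omega
  · rcases le_total s t with h | h
    · have := hc.dist_le_of_branch hv hx' h
      rw [SimpleGraph.dist_comm]
      omega
    · have := hc.dist_le_of_branch hx' hv h
      omega

end TopBottomGraph.IsCoding

/-! ### The embedding of a coded graph -/

section Embedding

variable {G : TopBottomGraph} {κ : Type} [Inhabited κ] [Fintype κ] [DecidableEq κ] {N : ℕ}
  {w : ℕ → ℕ} {c : G.V → ℕ × List κ} {X : Type*} [NormedAddCommGroup X] [NormedSpace ℝ X]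
  {e : ℕ → X}

/-- The image in the span of `e` of a vertex of a coded graph. -/
noncomputable def codeMap (c : G.V → ℕ × List κ) (w : ℕ → ℕ) (N D : ℕ) (e : ℕ → X) (v : G.V) : X :=
  Finsupp.linearCombination ℝ e (branchVec w N D (branchOf (c v).2) (c v).1)

theorem TopBottomGraph.IsCoding.dist_codeMap_le (hc : G.IsCoding N w c) (he : IsESA e) {D : ℕ}
    (hD : ∀ t ≤ N, w t ≤ D) (u v : G.V) :
    dist (codeMap c w N D e u) (codeMap c w N D e v) ≤
      altNorm e (orientationCard κ D) * G.graph.dist u v := by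
  have hup : ∀ u v, (c u).1 + 1 = (c v).1 → ((c u).2 <+: (c v).2 ∨ (c v).2 <+: (c u).2) →
      dist (codeMap c w N D e u) (codeMap c w N D e v) ≤ altNorm e (orientationCard κ D) := by
    intro u v h1 h2
    -- Adjacent vertices lie on a common branch, namely one through the longer sequence.
    obtain ⟨ξ, hξ, hξ'⟩ : ∃ ξ : ℕ → κ, (∀ i < w (c u).1, branchOf (c u).2 i = ξ i) ∧
        ∀ i < w (c v).1, branchOf (c v).2 i = ξ i := by
      rcases h2 with h2 | h2
      · exact ⟨_, fun i hi => branchOf_eq_of_prefix h2 (by rwa [hc.length]), fun i hi => rfl⟩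
      · exact ⟨_, fun i hi => rfl, fun i hi => branchOf_eq_of_prefix h2 (by rwa [hc.length])⟩
    have hv := hc.height_le v
    rw [codeMap, codeMap, branchVec_congr hc.level_zero hc.level_last hD (hc.height_le u) hξ,
      branchVec_congr hc.level_zero hc.level_last hD (hc.height_le v) hξ', ← h1, dist_comm,
      dist_eq_norm, ← map_sub]
    exact (he.norm_blockVec_succ hc.level_zero hc.level_last (by omega)).le
  have hadj : ∀ u v, G.graph.Adj u v →
      dist (codeMap c w N D e u) (codeMap c w N D e v) ≤ altNorm e (orientationCard κ D) := by
    intro u v h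
    rw [hc.adj] at h
    rcases h with ⟨h1 | h1, h2⟩
    · exact hup u v h1 h2
    · rw [dist_comm]
      exact hup v u h1 h2.symm
  have hwalk : ∀ {u v : G.V} (p : G.graph.Walk u v),
      dist (codeMap c w N D e u) (codeMap c w N D e v) ≤
        altNorm e (orientationCard κ D) * p.length := by
    intro u v p
    induction p with
    | nil => simp
    | cons h p ih =>
      refine (dist_triangle _ _ _).trans ((add_le_add (hadj _ _ h) ih).trans_eq ?_)
      rw [SimpleGraph.Walk.length_cons]
      push_cast
      ring
  obtain ⟨p, hp⟩ := (hc.connected.preconnected u v).exists_walk_length_eq_dist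
  rw [← hp]
  exact hwalk p

theorem TopBottomGraph.IsCoding.le_dist_codeMap (hc : G.IsCoding N w c) (he : IsESA e) {D m K : ℕ}
    (hcuts : HasSymmetricCuts N w m K) (hK : 1 ≤ K) (hD : ∀ t ≤ N, w t + m ≤ D) (u v : G.V) :
    altNorm e (orientationCard κ D) * G.graph.dist u v ≤
      4 ^ m * K * dist (codeMap c w N D e u) (codeMap c w N D e v) := by
  wlog hrs : (c u).1 ≤ (c v).1 generalizing u v
  · rw [SimpleGraph.dist_comm, dist_comm]
    exact this v u (le_of_not_ge hrs)
  have hw := hc.level_zero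
  have hwN := hc.level_last
  have hu := hc.eq_branch u
  have hv := hc.eq_branch v
  have hr := hc.height_le u
  have hs := hc.height_le v
  rw [codeMap, codeMap, dist_eq_norm, ← map_sub]
  generalize branchOf (c u).2 = ξ at hu ⊢
  generalize branchOf (c v).2 = η at hv ⊢
  generalize (c u).1 = r at hrs hu hr ⊢
  generalize (c v).1 = s at hrs hv hs ⊢
  have hD' : ∀ t ≤ N, w t ≤ D := fun t ht => by have := hD t ht; omega
  have hlam : 0 ≤ altNorm e (orientationCard κ D) := norm_nonneg _
  have hmono : G.graph.dist u v ≤ s - r →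
      altNorm e (orientationCard κ D) * G.graph.dist u v ≤ 4 ^ m * K *
        ‖Finsupp.linearCombination ℝ e (branchVec w N D ξ r - branchVec w N D η s)‖ := by
    intro hd
    have h1 := he.mul_altNorm_le_norm_blockVec_sub_of_length (D := D) (n := orientationCard κ D)
      (β := branchBits D ξ) (β' := branchBits D η) hw hwN hr hs
    have h2 : (G.graph.dist u v : ℝ) ≤ |(r : ℝ) - s| := by
      rw [abs_sub_comm, ← Nat.cast_sub hrs, Nat.abs_cast]
      exact_mod_cast hd
    have h3 : (1 : ℝ) ≤ 4 ^ m * K := by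
      have : 1 ≤ 4 ^ m * K := Nat.mul_pos (by positivity) hK
      exact_mod_cast this
    calc altNorm e (orientationCard κ D) * G.graph.dist u v
        ≤ |(r : ℝ) - s| * altNorm e (orientationCard κ D) := by
          rw [mul_comm]; exact mul_le_mul_of_nonneg_right h2 hlam
      _ ≤ _ := h1
      _ ≤ _ := le_mul_of_one_le_left (norm_nonneg _) h3
  by_cases hne : ∃ i, ξ i ≠ η i
  · classical
    set p := Nat.find hne with hp
    have hpne : ξ p ≠ η p := Nat.find_spec hne
    have hagree : ∀ i < p, ξ i = η i := fun i hi => not_not.1 (Nat.find_min hne hi)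
    -- Here `p` is the first place of disagreement. A shared vertex at a height between `r` and `s`
    -- makes the distance at most `s - r`. Otherwise both heights are interior to one cell of level
    -- `p`, and paths through its two ends bound the distance.
    by_cases ht : ∃ t, r ≤ t ∧ t ≤ s ∧ w t ≤ p
    · obtain ⟨t, h1, h2, h3⟩ := ht
      have := hc.dist_le_of_common hu hv (h2.trans hs) fun i hi => hagree i (hi.trans_le h3)
      exact hmono (by omega)
    · push Not at ht
      have hsN : s < N := by
        refine lt_of_le_of_ne hs fun h => ?_
        have := ht s hrs le_rfl
        rw [h, hwN] at this
        omega
      have hr0 := ht r le_rfl hrs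
      have l1 := levelLo_le (w := w) (p := p) (h := r)
      have l2 := level_levelLo (w := w) (p := p) (h := r) hw
      have l3 := levelHi_spec (w := w) (N := N) (p := p) hwN hsN
      have l4 := levelHi_le (p := p) hsN (hwN.le.trans (Nat.zero_le p))
      have l5 : levelLo w p r ≠ r := fun h => by rw [h] at l2; omega
      have hcell : IsCell w N p (levelLo w p r) (levelHi w p s) := by
        refine ⟨by omega, l4, l2, l3.2, fun t h1 h2 => ?_⟩
        by_contra hcon
        rw [not_lt] at hcon
        rcases lt_or_ge t r with h3 | h3
        · have := le_levelLo h3.le hcon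
          omega
        · rcases le_or_gt t s with h4 | h4
          · have := ht t h3 h4
            omega
          · have := levelHi_le h4 hcon
            omega
      have d1 := hc.dist_le_of_common (t := levelLo w p r) hu hv (by omega)
        fun i hi => hagree i (hi.trans_le l2)
      have d2 := hc.dist_le_of_common hu hv l4 fun i hi => hagree i (hi.trans_le l3.2)
      have hDr := hD r hr
      rw [mul_comm]
      exact he.le_norm_branchVec_sub_of_cell hw hwN hcuts hD' hcell (by omega) hagree hpne
        (by omega) (by omega) (by omega) (by omega) hrs (by omega) (by omega)
  · push Not at hne
    have := hc.dist_le_of_common (t := r) hu hv hr fun i _ => hne i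
    exact hmono (by omega)

/-- A coded graph with symmetric cuts embeds into every space with an ESA basis. -/
theorem TopBottomGraph.IsCoding.embedsWithDistortionLE (hc : G.IsCoding N w c) {m K : ℕ}
    (hcuts : HasSymmetricCuts N w m K) (hK : 1 ≤ K) (hX : HasESABasis X) :
    EmbedsWithDistortionLE G X (4 ^ m * K) := by
  obtain ⟨b, he⟩ := hX
  have hli : LinearIndependent ℝ (fun n => b n) := b.linearIndependent
  -- The surplus `m` leaves room for the `m` levels below any splitting level.
  obtain ⟨D, hD⟩ : ∃ D, ∀ t ≤ N, w t + m ≤ D :=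
    ⟨∑ t ∈ Finset.range (N + 1), w t + m, fun t ht => Nat.add_le_add_right
      (Finset.single_le_sum (f := w) (fun _ _ => Nat.zero_le _)
        (Finset.mem_range.2 (by omega))) m⟩
  have hlam : 0 < altNorm (fun n => b n) (orientationCard κ D) :=
    he.altNorm_pos hli Fintype.card_pos
  have hcon : (0 : ℝ) < 4 ^ m * K := by
    have : (0 : ℝ) < K := by exact_mod_cast hK
    positivity
  have hbl : IsBiLipschitzWith G.graph (codeMap c w N D (fun n => b n))
      (altNorm (fun n => b n) (orientationCard κ D) / (4 ^ m * K))
      (altNorm (fun n => b n) (orientationCard κ D)) := by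
    refine fun u v => ⟨?_, hc.dist_codeMap_le he (fun t ht => by have := hD t ht; omega) u v⟩
    rw [div_mul_eq_mul_div, div_le_iff₀ hcon, mul_comm (dist _ _)]
    exact hc.le_dist_codeMap he hcuts hK hD u v
  refine ⟨_, ⟨_, _, div_pos hlam hcon, hlam, hbl⟩, csInf_le ⟨0, ?_⟩
    ⟨_, _, div_pos hlam hcon, hlam, hbl, ?_⟩⟩
  · rintro x ⟨C₁, C₂, h1, h2, -, rfl⟩
    positivity
  · field_simp

end Embedding

/-! ### Bundle graphs and their products are coded -/

/-- The depth sequence, extended by zero. -/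
def DepthSequence.level (W : DepthSequence) (r : ℕ) : ℕ :=
  if h : r < W.M + 2 then W.w ⟨r, h⟩ else 0

theorem bundleGraph_isCoding (W : DepthSequence) (κ : Type) :
    (bundleGraph W κ).IsCoding (W.M + 1) W.level
      (fun v : {v : Fin (W.M + 2) × List κ // v.2.length = W.w v.1} => ((v.1.1 : ℕ), v.1.2)) where
  inj u v h := by
    rw [Prod.mk.injEq] at h
    exact Subtype.ext (Prod.ext (Fin.ext h.1) h.2)
  height_le v := Nat.lt_succ_iff.1 v.1.1.2
  length v := by
    rw [DepthSequence.level, dif_pos v.1.1.2]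
    exact v.2
  surj r A hr hA := by
    have hr' : r < W.M + 2 := Nat.lt_succ_of_le hr
    rw [DepthSequence.level, dif_pos hr'] at hA
    exact ⟨⟨(⟨r, hr'⟩, A), hA⟩, rfl⟩
  adj u v := Iff.rfl
  bottom := rfl
  top := rfl

/-- The depths of the product `⊘`, where `N'` is the height of the second factor. -/
def oslashLevel (N' : ℕ) (w w' : ℕ → ℕ) (h : ℕ) : ℕ :=
  if h % N' = 0 then w (h / N') else max (w (h / N')) (w (h / N' + 1)) + w' (h % N')

theorem oslashLevel_mul {N' : ℕ} (hN' : 0 < N') (w w' : ℕ → ℕ) (r : ℕ) :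
    oslashLevel N' w w' (r * N') = w r := by
  rw [oslashLevel, if_pos (Nat.mul_mod_left r N'), Nat.mul_div_cancel _ hN']

theorem oslashLevel_mul_add {N' : ℕ} (w w' : ℕ → ℕ) (r : ℕ) {a : ℕ} (ha : 0 < a) (ha' : a < N') :
    oslashLevel N' w w' (r * N' + a) = max (w r) (w (r + 1)) + w' a := by
  have h1 : (r * N' + a) % N' = a := by
    rw [Nat.mul_add_mod_self_right, Nat.mod_eq_of_lt ha']
  have h2 : (r * N' + a) / N' = r := by
    rw [mul_comm, Nat.mul_add_div (by omega), Nat.div_eq_of_lt ha', add_zero]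
  rw [oslashLevel, h1, h2, if_neg (by omega)]

theorem mul_add_inj {n a b x y : ℕ} (hx : x < n) (hy : y < n) (h : a * n + x = b * n + y) :
    a = b ∧ x = y := by
  have h1 := congrArg (· / n) h
  have h2 := congrArg (· % n) h
  simp only [Nat.mul_add_mod_self_right, Nat.mod_eq_of_lt hx, Nat.mod_eq_of_lt hy] at h2
  simp only [mul_comm _ n, Nat.mul_add_div (show 0 < n by omega), Nat.div_eq_of_lt hx,
    Nat.div_eq_of_lt hy, add_zero] at h1
  exact ⟨h1, h2⟩

theorem prefix_of_comparable {κ : Type*} {A B : List κ} (h : A <+: B ∨ B <+: A)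
    (hl : A.length ≤ B.length) : A <+: B := by
  rcases h with h | h
  · exact h
  · rw [h.eq_of_length (le_antisymm h.length_le hl)]

namespace TopBottomGraph

/-- The longer one of the sequences of the endpoints of an edge. -/
def UpEdge.longList {G : TopBottomGraph} {κ : Type} (c : G.V → ℕ × List κ) (e : G.UpEdge) :
    List κ :=
  if (c e.lower).2.length ≤ (c e.upper).2.length then (c e.upper).2 else (c e.lower).2

/-- The code of a vertex of `G ⊘ H`. -/
def oslashCode {G H : TopBottomGraph} {κ : Type} (N' : ℕ) (c : G.V → ℕ × List κ)
    (c' : H.V → ℕ × List κ) : G.V ⊕ (G.UpEdge × H.Inner) → ℕ × List κ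
  | .inl v => ((c v).1 * N', (c v).2)
  | .inr (e, x) => ((c e.lower).1 * N' + (c' x.1).1, e.longList c ++ (c' x.1).2)

namespace IsCoding

section

variable {G : TopBottomGraph} {κ : Type} {N : ℕ} {w : ℕ → ℕ} {c : G.V → ℕ × List κ}

theorem eq_bottom (hc : G.IsCoding N w c) {v : G.V} (h : (c v).1 = 0) : v = G.bottom := by
  refine hc.inj ?_
  rw [hc.bottom]
  refine Prod.ext h (List.length_eq_zero_iff.1 ?_)
  rw [hc.length, h, hc.level_zero]

theorem eq_top (hc : G.IsCoding N w c) {v : G.V} (h : (c v).1 = N) : v = G.top := by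
  refine hc.inj ?_
  rw [hc.top]
  refine Prod.ext h (List.length_eq_zero_iff.1 ?_)
  rw [hc.length, h, hc.level_last]

theorem inner_height (hc : G.IsCoding N w c) (x : G.Inner) : 0 < (c x.1).1 ∧ (c x.1).1 < N :=
  ⟨Nat.pos_of_ne_zero fun h => x.2.1 (hc.eq_bottom h),
    lt_of_le_of_ne (hc.height_le _) fun h => x.2.2 (hc.eq_top h)⟩

theorem lower_prefix (hc : G.IsCoding N w c) (e : G.UpEdge) :
    (c e.lower).2 <+: e.longList c := by
  have h := ((hc.adj _ _).1 e.2.1).2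
  rw [UpEdge.longList]
  split_ifs with hl
  · exact prefix_of_comparable h hl
  · exact List.prefix_refl _

theorem upper_prefix (hc : G.IsCoding N w c) (e : G.UpEdge) :
    (c e.upper).2 <+: e.longList c := by
  have h := ((hc.adj _ _).1 e.2.1).2
  rw [UpEdge.longList]
  split_ifs with hl
  · exact List.prefix_refl _
  · exact prefix_of_comparable h.symm (le_of_not_ge hl)

theorem eq_of_prefix (hc : G.IsCoding N w c) {u v : G.V} {A : List κ} (h : (c u).1 = (c v).1)
    (hu : (c u).2 <+: A) (hv : (c v).2 <+: A) : u = v := by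
  have hl : (c u).2.length = (c v).2.length := by rw [hc.length, hc.length, h]
  exact hc.inj (Prod.ext h ((List.prefix_of_prefix_length_le hu hv hl.le).eq_of_length hl))

variable [Inhabited κ]

theorem upper_height (hc : G.IsCoding N w c) (e : G.UpEdge) :
    (c e.upper).1 = (c e.lower).1 + 1 := by
  have h := e.2.2
  rw [hc.height_eq, hc.height_eq] at h
  exact h

theorem length_longList (hc : G.IsCoding N w c) (e : G.UpEdge) :
    (e.longList c).length = max (w (c e.lower).1) (w ((c e.lower).1 + 1)) := by
  rw [← hc.upper_height, UpEdge.longList, ← hc.length, ← hc.length]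
  split_ifs with h
  · rw [max_eq_right h]
  · rw [max_eq_left (le_of_not_ge h)]

theorem upEdge_ext (hc : G.IsCoding N w c) {e f : G.UpEdge} (h : (c e.lower).1 = (c f.lower).1)
    (h' : e.longList c = f.longList c) : e = f := by
  refine Subtype.ext (Prod.ext (hc.eq_of_prefix h (hc.lower_prefix e) (h' ▸ hc.lower_prefix f))
    (hc.eq_of_prefix ?_ (hc.upper_prefix e) (h' ▸ hc.upper_prefix f)))
  exact (hc.upper_height e).trans ((congrArg (· + 1) h).trans (hc.upper_height f).symm)

end

variable {G H : TopBottomGraph} {κ : Type} [Inhabited κ] {N N' : ℕ} {w w' : ℕ → ℕ}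
  {c : G.V → ℕ × List κ} {c' : H.V → ℕ × List κ}

theorem rel_of_code (hc : G.IsCoding N w c) (hc' : H.IsCoding N' w' c')
    (a b : G.V ⊕ (G.UpEdge × H.Inner))
    (h : (oslashCode N' c c' a).1 + 1 = (oslashCode N' c c' b).1)
    (h' : (oslashCode N' c c' a).2 <+: (oslashCode N' c c' b).2 ∨
      (oslashCode N' c c' b).2 <+: (oslashCode N' c c' a).2) : OslashRel G H a b := by
  have hN' := hc'.pos
  rcases a with u | ⟨e, x⟩ <;> rcases b with v | ⟨f, y⟩ <;> simp only [oslashCode] at h h'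
  · have h1 : N' = 1 := by
      by_contra hne
      have := (mul_add_inj (n := N') (a := (c u).1) (b := (c v).1) (x := 1) (y := 0) (by omega)
        hN' h).2
      omega
    subst h1
    rw [mul_one, mul_one] at h
    exact OslashRel.bottom_top (⟨(u, v), (hc.adj u v).2 ⟨Or.inl h, h'⟩, by
      rw [hc.height_eq, hc.height_eq, h]⟩ : G.UpEdge)
      ((hc'.adj _ _).2 ⟨by rw [hc'.bottom, hc'.top]; exact Or.inl rfl,
        by rw [hc'.bottom]; exact Or.inl List.nil_prefix⟩)
  · have hy := hc'.inner_height y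
    obtain ⟨h1, h2⟩ := mul_add_inj (n := N') (by omega) hy.2 h
    have h3 : u = f.lower := by
      refine hc.eq_of_prefix h1 (prefix_of_comparable h' ?_)
        ((hc.lower_prefix f).trans (List.prefix_append _ _))
      have := (hc.lower_prefix f).length_le
      rw [hc.length, ← h1, ← hc.length] at this
      rw [List.length_append]
      omega
    subst h3
    exact OslashRel.bottom_inner f y ((hc'.adj _ _).2
      ⟨by rw [hc'.bottom]; exact Or.inl (by simpa using h2),
        by rw [hc'.bottom]; exact Or.inl List.nil_prefix⟩)
  · have hx := hc'.inner_height x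
    have h1 : (c' x.1).1 + 1 = N' := by
      by_contra hne
      have := (mul_add_inj (n := N') (a := (c e.lower).1) (b := (c v).1) (x := (c' x.1).1 + 1)
        (y := 0) (by omega) hN' h).2
      omega
    have h2 : (c v).1 = (c e.upper).1 := by
      have h3 : ((c e.lower).1 + 1) * N' = (c v).1 * N' := by
        rw [add_mul, one_mul, ← h, add_assoc, h1]
      rw [hc.upper_height]
      exact (Nat.eq_of_mul_eq_mul_right hN' h3).symm
    have h3 : v = e.upper := by
      refine hc.eq_of_prefix h2 (prefix_of_comparable h'.symm ?_)
        ((hc.upper_prefix e).trans (List.prefix_append _ _))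
      have := (hc.upper_prefix e).length_le
      rw [hc.length, ← h2, ← hc.length] at this
      rw [List.length_append]
      omega
    subst h3
    exact OslashRel.inner_top e x ((hc'.adj _ _).2
      ⟨by rw [hc'.top]; exact Or.inl h1, by rw [hc'.top]; exact Or.inr List.nil_prefix⟩)
  · have hx := hc'.inner_height x
    have hy := hc'.inner_height y
    have h1 : (c' x.1).1 + 1 ≠ N' := by
      intro h1
      have h3 : ((c e.lower).1 + 1) * N' + 0 = (c f.lower).1 * N' + (c' y.1).1 := by
        rw [add_mul, one_mul, ← h, add_zero, add_assoc, h1]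
      have := (mul_add_inj hN' hy.2 h3).2
      omega
    obtain ⟨h2, h3⟩ := mul_add_inj (n := N') (x := (c' x.1).1 + 1) (by omega) hy.2 h
    have hlen : (e.longList c).length = (f.longList c).length := by
      rw [hc.length_longList, hc.length_longList, h2]
    have hl : e.longList c = f.longList c := by
      rcases h' with h' | h'
      · exact (List.prefix_of_prefix_length_le ((List.prefix_append _ _).trans h')
          (List.prefix_append _ _) hlen.le).eq_of_length hlen
      · exact ((List.prefix_of_prefix_length_le ((List.prefix_append _ _).trans h')
          (List.prefix_append _ _) hlen.ge).eq_of_length hlen.symm).symm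
    obtain rfl := hc.upEdge_ext h2 hl
    rw [List.prefix_append_right_inj, List.prefix_append_right_inj] at h'
    exact OslashRel.inner_inner e x y ((hc'.adj _ _).2 ⟨Or.inl h3, h'⟩)

theorem code_of_rel (hc : G.IsCoding N w c) (hc' : H.IsCoding N' w' c')
    {a b : G.V ⊕ (G.UpEdge × H.Inner)} (h : OslashRel G H a b) :
    ((oslashCode N' c c' a).1 + 1 = (oslashCode N' c c' b).1 ∨
      (oslashCode N' c c' b).1 + 1 = (oslashCode N' c c' a).1) ∧
    ((oslashCode N' c c' a).2 <+: (oslashCode N' c c' b).2 ∨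
      (oslashCode N' c c' b).2 <+: (oslashCode N' c c' a).2) := by
  have hN' := hc'.pos
  cases h with
  | bottom_top e h =>
    rw [hc'.adj, hc'.bottom, hc'.top] at h
    have h1 : N' = 1 := by simp only at h; omega
    subst h1
    simp only [oslashCode, mul_one]
    exact ⟨Or.inl (hc.upper_height e).symm, ((hc.adj _ _).1 e.2.1).2⟩
  | bottom_inner e x h =>
    rw [hc'.adj, hc'.bottom] at h
    have h1 : (c' x.1).1 = 1 := by simp only at h; omega
    simp only [oslashCode, h1]
    exact ⟨by simp, Or.inl ((hc.lower_prefix e).trans (List.prefix_append _ _))⟩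
  | inner_top e x h =>
    rw [hc'.adj, hc'.top] at h
    have hx := hc'.inner_height x
    have h1 : (c' x.1).1 + 1 = N' := by simp only at h; omega
    simp only [oslashCode]
    refine ⟨Or.inl ?_, Or.inr ((hc.upper_prefix e).trans (List.prefix_append _ _))⟩
    rw [hc.upper_height, add_mul, one_mul, add_assoc, h1]
  | inner_inner e x y h =>
    rw [hc'.adj] at h
    simp only [oslashCode]
    refine ⟨by omega, ?_⟩
    rw [List.prefix_append_right_inj, List.prefix_append_right_inj]
    exact h.2

/-- The product of coded graphs is coded. -/
theorem oslash (hc : G.IsCoding N w c) (hc' : H.IsCoding N' w' c') :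
    (G.oslash H).IsCoding (N * N') (oslashLevel N' w w') (oslashCode N' c c') where
  inj := by
    have hN' := hc'.pos
    rintro (u | ⟨e, x⟩) (v | ⟨f, y⟩) h <;> simp only [oslashCode, Prod.mk.injEq] at h
    · exact congrArg _ (hc.inj (Prod.ext (Nat.eq_of_mul_eq_mul_right hN' h.1) h.2))
    · have hy := hc'.inner_height y
      have := (mul_add_inj (n := N') (x := 0) hN' hy.2 h.1).2
      omega
    · have hx := hc'.inner_height x
      have := (mul_add_inj (n := N') (y := 0) hx.2 hN' h.1).2
      omega
    · have hx := hc'.inner_height x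
      have hy := hc'.inner_height y
      obtain ⟨h1, h2⟩ := mul_add_inj hx.2 hy.2 h.1
      obtain ⟨h3, h4⟩ := List.append_inj h.2 (by
        rw [hc.length_longList, hc.length_longList, h1])
      rw [hc.upEdge_ext h1 h3, Subtype.ext (hc'.inj (Prod.ext h2 h4))]
  height_le := by
    rintro (v | ⟨e, x⟩) <;> simp only [oslashCode]
    · exact Nat.mul_le_mul_right _ (hc.height_le v)
    · have h1 := hc.height_le e.upper
      rw [hc.upper_height] at h1
      have h2 := Nat.mul_le_mul_right N' h1
      have h3 := hc'.height_le x.1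
      rw [add_mul, one_mul] at h2
      omega
  length := by
    rintro (v | ⟨e, x⟩) <;> simp only [oslashCode]
    · rw [oslashLevel_mul hc'.pos, hc.length]
    · have hx := hc'.inner_height x
      rw [oslashLevel_mul_add _ _ _ hx.1 hx.2, List.length_append, hc.length_longList, hc'.length]
  surj := by
    intro h A hh hA
    have hN' := hc'.pos
    have hdm : h / N' * N' + h % N' = h := by rw [mul_comm]; exact Nat.div_add_mod h N'
    have hlt := Nat.mod_lt h hN'
    generalize h / N' = r at hdm
    generalize h % N' = r' at hdm hlt
    rcases Nat.eq_zero_or_pos r' with rfl | hr'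
    · rw [← hdm, add_zero, oslashLevel_mul hN'] at hA
      rw [← hdm, add_zero] at hh
      obtain ⟨v, hv⟩ := hc.surj r A (Nat.le_of_mul_le_mul_right hh hN') hA
      refine ⟨Sum.inl v, ?_⟩
      simp only [oslashCode, hv, ← hdm, add_zero]
    · rw [← hdm, oslashLevel_mul_add _ _ _ hr' hlt] at hA
      have hr : r + 1 ≤ N := by
        by_contra hcon
        have := Nat.mul_le_mul_right N' (show N ≤ r by omega)
        omega
      obtain ⟨u, hu⟩ := hc.surj r (A.take (w r)) (by omega) (by rw [List.length_take]; omega)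
      obtain ⟨v, hv⟩ := hc.surj (r + 1) (A.take (w (r + 1))) hr (by
        rw [List.length_take]; omega)
      obtain ⟨x, hx⟩ := hc'.surj r' (A.drop (max (w r) (w (r + 1)))) hlt.le (by
        rw [List.length_drop]; omega)
      have hadj : G.graph.Adj u v := by
        rw [hc.adj, hu, hv]
        refine ⟨Or.inl rfl, ?_⟩
        rcases le_total (w r) (w (r + 1)) with hl | hl
        · exact Or.inl (List.take_prefix_take_left hl)
        · exact Or.inr (List.take_prefix_take_left hl)
      have hx0 : x ≠ H.bottom := by
        rintro rfl
        rw [hc'.bottom, Prod.mk.injEq] at hx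
        omega
      have hx1 : x ≠ H.top := by
        rintro rfl
        rw [hc'.top, Prod.mk.injEq] at hx
        omega
      refine ⟨Sum.inr (⟨(u, v), hadj, by rw [hc.height_eq, hc.height_eq, hu, hv]⟩,
        ⟨x, hx0, hx1⟩), ?_⟩
      simp only [oslashCode, UpEdge.longList, UpEdge.lower, UpEdge.upper, hu, hv, hx,
        List.length_take]
      refine Prod.ext hdm ?_
      simp only
      rw [← List.take_append_drop (max (w r) (w (r + 1))) A]
      congr 1
      · rw [List.take_append_drop]
        split_ifs with hl
        · rw [max_eq_right (by omega)]
        · rw [max_eq_left (by omega)]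
      · rw [List.take_append_drop]
  adj := by
    intro a b
    refine (SimpleGraph.fromRel_adj (OslashRel G H) a b).trans ?_
    constructor
    · rintro ⟨-, h | h⟩
      · exact code_of_rel hc hc' h
      · exact ⟨(code_of_rel hc hc' h).1.symm, (code_of_rel hc hc' h).2.symm⟩
    · rintro ⟨h1, h2⟩
      refine ⟨?_, ?_⟩
      · rintro rfl
        omega
      · rcases h1 with h1 | h1
        · exact Or.inl (rel_of_code hc hc' a b h1 h2)
        · exact Or.inr (rel_of_code hc hc' b a h1 h2.symm)
  bottom := by
    change ((c G.bottom).1 * N', (c G.bottom).2) = (0, [])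
    rw [hc.bottom, zero_mul]
  top := by
    change ((c G.top).1 * N', (c G.top).2) = (N * N', [])
    rw [hc.top]

end IsCoding

end TopBottomGraph

/-! ### Symmetric cuts -/

/-- A cell with a multiple of `N'` in its interior is a cell of the first factor scaled by `N'`, and
its cut is scaled too. Any other cell lies inside one inserted copy and is a cell of the second
factor, with levels shifted by the depth of the replaced edge. Ratios are unchanged, so the
constants survive iteration. -/
theorem HasSymmetricCuts.oslash {N N' m K : ℕ} {w w' : ℕ → ℕ} (hN' : 0 < N') (hw0 : w' 0 = 0)
    (hwN : w' N' = 0) (h : HasSymmetricCuts N w m K) (h' : HasSymmetricCuts N' w' m K) :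
    HasSymmetricCuts (N * N') (oslashLevel N' w w') m K := by
  intro p l u hc hlu
  have hl : l / N' * N' + l % N' = l := by rw [mul_comm]; exact Nat.div_add_mod l N'
  have hu : u / N' * N' + u % N' = u := by rw [mul_comm]; exact Nat.div_add_mod u N'
  have hla := Nat.mod_lt l hN'
  have hub := Nat.mod_lt u hN'
  generalize l / N' = r at hl
  generalize l % N' = a at hl hla
  generalize u / N' = s at hu
  generalize u % N' = b at hu hub
  have hlev1 := hc.level_left
  have hlev2 := hc.level_right
  by_cases hmul : ∃ t, l < t * N' ∧ t * N' < u
  · obtain ⟨t, ht1, ht2⟩ := hmul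
    -- An end interior to a copy is at least as deep as both ends of that copy; one of these would
    -- then lie inside the cell with level at most `p`.
    have ha : a = 0 := by
      by_contra ha
      rw [← hl, oslashLevel_mul_add _ _ _ (by omega) hla] at hlev1
      have h1 : r + 1 ≤ t := by
        by_contra hcon
        have := Nat.mul_le_mul_right N' (show t ≤ r by omega)
        omega
      have h2 := Nat.mul_le_mul_right N' h1
      have h3 := hc.level_inner ((r + 1) * N') (by rw [add_mul, one_mul]; omega) (by omega)
      rw [oslashLevel_mul hN'] at h3
      omega
    have hb : b = 0 := by
      by_contra hb
      rw [← hu, oslashLevel_mul_add _ _ _ (by omega) hub] at hlev2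
      have h1 : t ≤ s := by
        by_contra hcon
        have := Nat.mul_le_mul_right N' (show s + 1 ≤ t by omega)
        rw [add_mul, one_mul] at this
        omega
      have h2 := Nat.mul_le_mul_right N' h1
      have h3 := hc.level_inner (s * N') (by omega) (by omega)
      rw [oslashLevel_mul hN'] at h3
      omega
    subst ha hb
    rw [add_zero] at hl hu
    subst hl hu
    rw [oslashLevel_mul hN'] at hlev1 hlev2
    have hrt : r < t := Nat.lt_of_mul_lt_mul_right ht1
    have hts : t < s := Nat.lt_of_mul_lt_mul_right ht2
    have hcell : IsCell w N p r s := by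
      refine ⟨hrt.trans hts, Nat.le_of_mul_le_mul_right hc.le hN', hlev1, hlev2, fun i h1 h2 => ?_⟩
      have := hc.level_inner (i * N') (Nat.mul_lt_mul_of_pos_right h1 hN')
        (Nat.mul_lt_mul_of_pos_right h2 hN')
      rwa [oslashLevel_mul hN'] at this
    obtain ⟨q, h1, h2, h3, h4, h5⟩ := h p r s hcell (by omega)
    refine ⟨q * N', Nat.mul_pos h1 hN', ?_, ?_, ?_, ?_⟩
    · rw [← mul_assoc, ← Nat.sub_mul]
      exact Nat.mul_le_mul_right _ h2
    · rw [← mul_assoc, ← Nat.sub_mul]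
      exact Nat.mul_le_mul_right _ h3
    · rw [← add_mul, oslashLevel_mul hN']
      exact h4
    · rw [← Nat.sub_mul, oslashLevel_mul hN']
      exact h5
  · push Not at hmul
    have hu' : u ≤ r * N' + N' := by
      have := hmul (r + 1) (by rw [add_mul, one_mul]; omega)
      rwa [add_mul, one_mul] at this
    obtain ⟨b', rfl⟩ : ∃ b', u = r * N' + b' := ⟨u - r * N', by omega⟩
    subst hl
    set x := max (w r) (w (r + 1)) with hx
    have hinner : ∀ t, 0 < t → t < N' → oslashLevel N' w w' (r * N' + t) = x + w' t :=
      fun t h1 h2 => oslashLevel_mul_add _ _ _ h1 h2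
    have hxp : x ≤ p := by
      rcases Nat.eq_zero_or_pos a with rfl | ha
      · rcases (show b' ≤ N' by omega).eq_or_lt with rfl | hb'
        · rw [add_zero, oslashLevel_mul hN'] at hlev1
          rw [show r * b' + b' = (r + 1) * b' by ring, oslashLevel_mul hN'] at hlev2
          omega
        · rw [hinner b' (by omega) hb'] at hlev2
          omega
      · rw [hinner a ha hla] at hlev1
        omega
    have hcell : IsCell w' N' (p - x) a b' := by
      refine ⟨by omega, by omega, ?_, ?_, fun t h1 h2 => ?_⟩
      · rcases Nat.eq_zero_or_pos a with rfl | ha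
        · omega
        · rw [hinner a ha hla] at hlev1
          omega
      · rcases (show b' ≤ N' by omega).eq_or_lt with rfl | hb'
        · omega
        · rw [hinner b' (by omega) hb'] at hlev2
          omega
      · have := hc.level_inner (r * N' + t) (by omega) (by omega)
        rw [hinner t (by omega) (by omega)] at this
        omega
    obtain ⟨q, h1, h2, h3, h4, h5⟩ := h' (p - x) a b' hcell (by omega)
    refine ⟨q, h1, by omega, by omega, ?_, ?_⟩
    · rw [add_assoc, hinner _ (by omega) (by omega)]
      omega
    · rw [Nat.add_sub_assoc (by omega), hinner _ (by omega) (by omega)]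
      omega

/-- With `m` bounding all depths every height is an admissible cut, so `q = 1` works, at the price
`K = N`. -/
theorem hasSymmetricCuts_of_le {N m : ℕ} {w : ℕ → ℕ} (h : ∀ t ≤ N, w t ≤ m) :
    HasSymmetricCuts N w m N := by
  intro p l u hc hlu
  have := hc.le
  exact ⟨1, le_rfl, by omega, by omega, (h _ (by omega)).trans (Nat.le_add_left m p),
    (h _ (by omega)).trans (Nat.le_add_left m p)⟩

/-- If only one height has positive depth, which is `1`, then all cells are cut at their midpoint. -/
theorem hasSymmetricCuts_of_single {N t₀ : ℕ} {w : ℕ → ℕ} (h1 : w t₀ ≤ 1)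
    (h0 : ∀ t, t ≠ t₀ → w t = 0) : HasSymmetricCuts N w 1 2 := by
  intro p l u hc hlu
  have h2 := hc.level_inner (l + 1) (by omega) (by omega)
  -- An interior point of a cell has positive depth, so it must be `t₀`. Hence the cell has length
  -- two.
  have h3 : l + 1 = t₀ := by
    by_contra hne
    rw [h0 _ hne] at h2
    omega
  have h4 : u = l + 2 := by
    by_contra hne
    have h5 := hc.level_inner (l + 2) (by omega) (by omega)
    rw [h0 _ (by omega)] at h5
    omega
  subst h4
  refine ⟨1, le_rfl, by omega, by omega, ?_, ?_⟩
  · rw [h3]; omega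
  · rw [show l + 2 - 1 = t₀ by omega]; omega

/-! ### Iterated products and the final constants -/

theorem exists_isCoding_generated (W : DepthSequence) (κ : Type) [Inhabited κ] {m K : ℕ}
    (h : HasSymmetricCuts (W.M + 1) W.level m K) (k : ℕ) :
    ∃ (N : ℕ) (w : ℕ → ℕ) (c : ((bundleGraph W κ).generated k).V → ℕ × List κ),
      ((bundleGraph W κ).generated k).IsCoding N w c ∧ HasSymmetricCuts N w m K := by
  have h1 := bundleGraph_isCoding W κ
  induction k with
  | zero => exact ⟨_, _, _, h1, h⟩
  | succ k ih =>
    obtain ⟨N, w, c, hc, hcuts⟩ := ih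
    exact ⟨_, _, _, hc.oslash h1, hcuts.oslash h1.pos h1.level_zero h1.level_last h⟩

theorem embedsWithDistortionLE_generated (W : DepthSequence) {m K : ℕ}
    (h : HasSymmetricCuts (W.M + 1) W.level m K) (hK : 1 ≤ K) (κ : ℕ) (hκ : 1 ≤ κ)
    (X : Type*) [NormedAddCommGroup X] [NormedSpace ℝ X] (hX : HasESABasis X) (k : ℕ) :
    EmbedsWithDistortionLE ((bundleGraph W (Fin κ)).generated k) X (4 ^ m * K) := by
  have : Inhabited (Fin κ) := ⟨⟨0, hκ⟩⟩
  obtain ⟨N, w, c, hc, hcuts⟩ := exists_isCoding_generated W (Fin κ) h k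
  exact hc.embedsWithDistortionLE hcuts hK hX

theorem diamondSequence_cuts :
    HasSymmetricCuts (diamondSequence.M + 1) diamondSequence.level 1 2 := by
  refine hasSymmetricCuts_of_single (t₀ := 1) le_rfl fun t ht => ?_
  by_cases h : t < 3
  · interval_cases t <;> first | rfl | exact absurd rfl ht
  · exact dif_neg h

theorem laaksoSequence_cuts :
    HasSymmetricCuts (laaksoSequence.M + 1) laaksoSequence.level 1 2 := by
  refine hasSymmetricCuts_of_single (t₀ := 2) le_rfl fun t ht => ?_
  by_cases h : t < 5
  · interval_cases t <;> first | rfl | exact absurd rfl ht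
  · exact dif_neg h

theorem parasolSequence_cuts :
    HasSymmetricCuts (parasolSequence.M + 1) parasolSequence.level 1 2 := by
  refine hasSymmetricCuts_of_single (t₀ := 2) le_rfl fun t ht => ?_
  by_cases h : t < 4
  · interval_cases t <;> first | rfl | exact absurd rfl ht
  · exact dif_neg h

theorem mainTheorem5 :
    (∀ W : DepthSequence, ∃ C : ℝ, ∀ κ : ℕ, 1 ≤ κ →
      ∀ (X : Type*) [NormedAddCommGroup X] [NormedSpace ℝ X] [CompleteSpace X],
        HasESABasis X →
          ∀ k : ℕ, EmbedsWithDistortionLE ((bundleGraph W (Fin κ)).generated k) X C) ∧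
    (∀ κ : ℕ, 1 ≤ κ →
      ∀ (X : Type*) [NormedAddCommGroup X] [NormedSpace ℝ X] [CompleteSpace X],
        HasESABasis X → ∀ k : ℕ,
          EmbedsWithDistortionLE ((bundleGraph diamondSequence (Fin κ)).generated k) X 8 ∧
          EmbedsWithDistortionLE ((bundleGraph laaksoSequence (Fin κ)).generated k) X 8 ∧
          EmbedsWithDistortionLE ((bundleGraph parasolSequence (Fin κ)).generated k) X 8) := by
  -- The sum of all depths is a convenient upper bound for each of them, and serves as `m`; `K` is
  -- the height of the base graph.
  refine ⟨fun W => ⟨4 ^ (∑ t ∈ Finset.range (W.M + 2), W.level t) * (W.M + 1 : ℕ),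
    fun κ hκ X _ _ _ hX k => ?_⟩, fun κ hκ X _ _ _ hX k => ?_⟩
  · exact embedsWithDistortionLE_generated W (hasSymmetricCuts_of_le fun t ht =>
      Finset.single_le_sum (f := W.level) (fun _ _ => Nat.zero_le _)
        (Finset.mem_range.2 (by omega))) (Nat.succ_pos _) κ hκ X hX k
  -- Midpoint cuts one level deeper: `m = 1` and `K = 2`.
  · have h8 : (8 : ℝ) = 4 ^ 1 * (2 : ℕ) := by norm_num
    rw [h8]
    exact ⟨embedsWithDistortionLE_generated _ diamondSequence_cuts one_le_two κ hκ X hX k,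
      embedsWithDistortionLE_generated _ laaksoSequence_cuts one_le_two κ hκ X hX k,
      embedsWithDistortionLE_generated _ parasolSequence_cuts one_le_two κ hκ X hX k⟩
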